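/- A prop is a strict symmetric monoidal category whose monoid of objects is $(\mathbb{N},+)$; a prop functor is a strict symmetric monoidal functor that is the identity on objects. A traced prop is a prop with operators $\mathrm{tr}$, taking a morphism $1+m\to 1+n$ to a morphism $m\to n$, which satisfy, with $\mathrm{tr}_k$ the $k$-th iterate of $\mathrm{tr}$: tightening $\mathrm{tr}((\mathrm{id}_1\otimes g)\circ f\circ(\mathrm{id}_1\otimes h))=g\circ\mathrm{tr}(f)\circ h$; yanking $\mathrm{tr}(\sigma_{1,1})=\mathrm{id}_1$; sliding $\mathrm{tr}_n(f\circ(g\otimes\mathrm{id}_p))=\mathrm{tr}_m((g\otimes\mathrm{id}_q)\circ f)$ for $f:m+p\to n+q$ and $g:n\to m$; strength $\mathrm{tr}(f\otimes g)=\mathrm{tr}(f)\otimes g$. A traced prop functor is a prop functor that preserves $\mathrm{tr}$. A traced completion of a prop $P$ is a traced prop $\widehat P$ with a prop functor $\iota:P\to\widehat P$ such that for every traced prop $Q$ and every prop functor $\eta:P\to Q$ there is a unique traced prop functor $G:\widehat P\to Q$ with $G\iota=\eta$. For a semiring $R$ (not necessarily commutative), let $M_{\star,\star}(R)$ be the prop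 whose morphisms $n\to m$ are the $m\times n$ matrices over $R$, with the matrix product as composition and the direct sum as tensor product. PS-equivalence over $R$ is the smallest equivalence relation $\simeq$ on square matrices over $R$ (of all sizes) such that $AB\simeq BA$ for all $n\times m$ matrices $A$ and $m\times n$ matrices $B$, and $$\begin{pmatrix} a\\ A\end{pmatrix}\simeq\begin{pmatrix}0&1\\ A&0\\ a&0\end{pmatrix}$$ for every nonempty square matrix with first row $a$ and remaining rows $A$. For $R=\mathbb{Z}_+$ (the nonnegative integers), PS-equivalence is called flow equivalence. (1) Let $R$ be a semiring and let $(\widehat P,\iota)$ be a traced completion of $P=M_{\star,\star}(R)$. For all square matrices $M$ of size $n$ and $N$ of size $m$ over $R$, the morphisms $[M,n]=\mathrm{tr}_n(\iota(M))$ and $[N,m]=\mathrm{tr}_m(\iota(N))$ from $0$ to $0$ in $\widehat P$ are equal if and only if $M$ and $N$ are PS-equivalent over $R$. In particular, for $R=\mathbb{Z}_+$, they are equal if and only if $M$ and $N$ are flow equivalent. (2) Let $T$ be the traced bialgebra prop, that is, the traced prop presented by generators $\mu:2\to1$, $\eta:0\to1$, $\Delta:1\to2$, $\epsilon:1\to0$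 and the equations saying that $(\mu,\eta)$ is a commutative monoid, $(\Delta,\epsilon)$ is a cocommutative comonoid, and $\Delta\circ\eta=\eta\otimes\eta$, $\epsilon\circ\mu=\epsilon\otimes\epsilon$, $\epsilon\circ\eta=\mathrm{id}_0$, $(\mu\otimes\mu)\circ(\mathrm{id}_1\otimes\sigma_{1,1}\otimes\mathrm{id}_1)\circ(\Delta\otimes\Delta)=\Delta\circ\mu$. There is a unique prop functor $F:M_{\star,\star}(\mathbb{Z}_+)\to T$ that sends the matrices $\begin{pmatrix}1&1\end{pmatrix}$, the $1\times 0$ matrix, $\begin{pmatrix}1\\1\end{pmatrix}$ and the $0\times1$ matrix to $\mu$, $\eta$, $\Delta$ and $\epsilon$ respectively, and for all square matrices $M$ of size $n$ and $N$ of size $m$ over $\mathbb{Z}_+$ one has $\mathrm{tr}_n(F(M))=\mathrm{tr}_m(F(N))$ if and only if $M$ and $N$ are flow equivalent. -/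

import Mathlib

universe u v w

/-- Transport of a morphism `a → b` along equalities of its source and its target. -/
def homCast {H : ℕ → ℕ → Type u} {a a' b b' : ℕ} (ha : a = a') (hb : b = b') (f : H a b) :
    H a' b' :=
  hb ▸ ha ▸ f

/-- A prop: a strict symmetric monoidal category whose monoid of objects is `(ℕ, +)`.
`comp f g` is `f ∘ g` and `braid a b` is the symmetry that exchanges the first `a` wires
and the last `b` wires. -/
structure PROP where
  Hom : ℕ → ℕ → Type u
  id : ∀ a : ℕ, Hom a a
  comp : ∀ {a b c : ℕ}, Hom b c → Hom a b → Hom a c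
  tensor : ∀ {a b c d : ℕ}, Hom a b → Hom c d → Hom (a + c) (b + d)
  braid : ∀ a b : ℕ, Hom (a + b) (b + a)
  comp_assoc : ∀ {a b c d : ℕ} (f : Hom c d) (g : Hom b c) (h : Hom a b),
    comp (comp f g) h = comp f (comp g h)
  id_comp : ∀ {a b : ℕ} (f : Hom a b), comp (id b) f = f
  comp_id : ∀ {a b : ℕ} (f : Hom a b), comp f (id a) = f
  tensor_assoc : ∀ {a b c d e g : ℕ} (f : Hom a b) (h : Hom c d) (k : Hom e g),
    homCast (Nat.add_assoc a c e) (Nat.add_assoc b d g) (tensor (tensor f h) k) =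
      tensor f (tensor h k)
  tensor_comp : ∀ {a b c a' b' c' : ℕ} (f : Hom b c) (g : Hom a b)
    (h : Hom b' c') (k : Hom a' b'),
    tensor (comp f g) (comp h k) = comp (tensor f h) (tensor g k)
  tensor_id : ∀ a b : ℕ, tensor (id a) (id b) = id (a + b)
  tensor_empty : ∀ {a b : ℕ} (f : Hom a b),
    homCast (Nat.add_zero a) (Nat.add_zero b) (tensor f (id 0)) = f
  empty_tensor : ∀ {a b : ℕ} (f : Hom a b),
    homCast (Nat.zero_add a) (Nat.zero_add b) (tensor (id 0) f) = f
  braid_braid : ∀ a b : ℕ, comp (braid b a) (braid a b) = id (a + b)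
  braid_natural : ∀ {a b c d : ℕ} (f : Hom a b) (g : Hom c d),
    comp (braid b d) (tensor f g) = comp (tensor g f) (braid a c)
  braid_add : ∀ a b c : ℕ,
    braid (a + b) c =
      homCast rfl (Nat.add_assoc c a b)
        (comp (tensor (braid a c) (id b))
          (homCast (Nat.add_assoc a b c).symm (Nat.add_assoc a c b).symm
            (tensor (id a) (braid b c))))

/-- Prop functors. -/
@[ext]
structure PROPFunctor (P : PROP.{u}) (Q : PROP.{v}) where
  map : ∀ {a b : ℕ}, P.Hom a b → Q.Hom a b
  map_id : ∀ a : ℕ, map (P.id a) = Q.id a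
  map_comp : ∀ {a b c : ℕ} (f : P.Hom b c) (g : P.Hom a b),
    map (P.comp f g) = Q.comp (map f) (map g)
  map_tensor : ∀ {a b c d : ℕ} (f : P.Hom a b) (g : P.Hom c d),
    map (P.tensor f g) = Q.tensor (map f) (map g)
  map_braid : ∀ a b : ℕ, map (P.braid a b) = Q.braid a b

/-- Composition of prop functors: first `F`, then `G`. -/
def PROPFunctor.trans {P : PROP.{u}} {Q : PROP.{v}} {S : PROP.{w}}
    (F : PROPFunctor P Q) (G : PROPFunctor Q S) : PROPFunctor P S where
  map f := G.map (F.map f)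
  map_id a := by rw [F.map_id, G.map_id]
  map_comp f g := by rw [F.map_comp, G.map_comp]
  map_tensor f g := by rw [F.map_tensor, G.map_tensor]
  map_braid a b := by rw [F.map_braid, G.map_braid]

/-- The `k`-th iterate of an operator that closes the first wire: it closes the first `k`
wires. -/
def trIter {H : ℕ → ℕ → Type u} (tr : ∀ {m n : ℕ}, H (1 + m) (1 + n) → H m n) :
    ∀ (k : ℕ) {m n : ℕ}, H (k + m) (k + n) → H m n
  | 0, m, n, f => homCast (Nat.zero_add m) (Nat.zero_add n) f
  | k + 1, m, n, f => trIter tr k (tr (homCast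
      ((congrArg (· + m) (Nat.add_comm k 1)).trans (Nat.add_assoc 1 k m))
      ((congrArg (· + n) (Nat.add_comm k 1)).trans (Nat.add_assoc 1 k n)) f))

/-- A traced prop: a prop with an operator `tr` that plugs the first output into the first
input. -/
structure TracedPROP extends PROP.{u} where
  tr : ∀ {m n : ℕ}, Hom (1 + m) (1 + n) → Hom m n
  tightening : ∀ {a b c d : ℕ} (g : Hom c d) (f : Hom (1 + b) (1 + c)) (h : Hom a b),
    tr (comp (comp (tensor (id 1) g) f) (tensor (id 1) h)) = comp (comp g (tr f)) h
  yanking : tr (braid 1 1) = id 1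
  sliding : ∀ {m n p q : ℕ} (f : Hom (m + p) (n + q)) (g : Hom n m),
    trIter tr n (comp f (tensor g (id p))) = trIter tr m (comp (tensor g (id q)) f)
  strength : ∀ {a b c d : ℕ} (f : Hom (1 + a) (1 + b)) (g : Hom c d),
    tr (homCast (Nat.add_assoc 1 a c) (Nat.add_assoc 1 b d) (tensor f g)) = tensor (tr f) g

/-- The full trace `n → n` to `0 → 0`, i.e. the `n`-th iterate of the trace. -/
def TracedPROP.fullTrace (T : TracedPROP.{u}) {n : ℕ} (f : T.Hom n n) : T.Hom 0 0 :=
  trIter T.tr n (m := 0) (n := 0) f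

/-- Traced prop functors. -/
@[ext]
structure TracedFunctor (S : TracedPROP.{u}) (T : TracedPROP.{v}) extends
    PROPFunctor S.toPROP T.toPROP where
  map_tr : ∀ {m n : ℕ} (f : S.Hom (1 + m) (1 + n)), map (S.tr f) = T.tr (map f)

/-- The traced prop `T`, with the prop functor `ι : P → T`, is a traced completion of the
prop `P`. -/
def IsTracedCompletion {P : PROP.{u}} (T : TracedPROP.{u}) (ι : PROPFunctor P T.toPROP) :
    Prop :=
  ∀ (Q : TracedPROP.{u}) (η : PROPFunctor P Q.toPROP),
    ∃! G : TracedFunctor T Q, ι.trans G.toPROPFunctor = η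

/-- A bicommutative bialgebra in a prop, on the object `1`. -/
@[ext]
structure Bialg (P : PROP.{u}) where
  mul : P.Hom 2 1
  unit : P.Hom 0 1
  comul : P.Hom 1 2
  counit : P.Hom 1 0
  unit_mul : P.comp mul (P.tensor unit (P.id 1)) = P.id 1
  mul_unit : P.comp mul (P.tensor (P.id 1) unit) = P.id 1
  mul_assoc : P.comp mul (P.tensor mul (P.id 1)) = P.comp mul (P.tensor (P.id 1) mul)
  mul_comm : P.comp mul (P.braid 1 1) = mul
  counit_comul : P.comp (b := 1 + 1) (P.tensor counit (P.id 1)) comul = P.id 1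
  comul_counit : P.comp (b := 1 + 1) (P.tensor (P.id 1) counit) comul = P.id 1
  comul_assoc : P.comp (b := 1 + 1) (P.tensor comul (P.id 1)) comul =
    P.comp (b := 1 + 1) (P.tensor (P.id 1) comul) comul
  comul_comm : P.comp (P.braid 1 1) comul = comul
  comul_unit : P.comp comul unit = P.tensor unit unit
  counit_mul : P.comp counit mul = P.tensor counit counit
  counit_unit : P.comp counit unit = P.id 0
  comul_mul : P.comp (a := 2) (b := 4) (c := 2)
    (P.comp (a := 4) (b := 4) (c := 2) (P.tensor mul mul)
      (P.tensor (b := 1 + (1 + 1)) (P.tensor (P.id 1) (P.braid 1 1)) (P.id 1)))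
    (P.tensor comul comul) = P.comp comul mul

/-- The image of a bialgebra under a prop functor. -/
def Bialg.image {P : PROP.{u}} {Q : PROP.{v}} (B : Bialg P) (F : PROPFunctor P Q) : Bialg Q where
  mul := F.map B.mul
  unit := F.map B.unit
  comul := F.map B.comul
  counit := F.map B.counit
  unit_mul := by
    have h := congrArg F.map B.unit_mul
    rwa [F.map_comp, F.map_tensor, F.map_id] at h
  mul_unit := by
    have h := congrArg F.map B.mul_unit
    rwa [F.map_comp, F.map_tensor, F.map_id] at h
  mul_assoc := by
    have h := congrArg F.map B.mul_assoc
    rwa [F.map_comp, F.map_tensor, F.map_comp, F.map_tensor, F.map_id] at h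
  mul_comm := by
    have h := congrArg F.map B.mul_comm
    rwa [F.map_comp, F.map_braid] at h
  counit_comul := by
    have h := congrArg F.map B.counit_comul
    rwa [F.map_comp, F.map_tensor, F.map_id] at h
  comul_counit := by
    have h := congrArg F.map B.comul_counit
    rwa [F.map_comp, F.map_tensor, F.map_id] at h
  comul_assoc := by
    have h := congrArg F.map B.comul_assoc
    rwa [F.map_comp, F.map_tensor, F.map_comp, F.map_tensor, F.map_id] at h
  comul_comm := by
    have h := congrArg F.map B.comul_comm
    rwa [F.map_comp, F.map_braid] at h
  comul_unit := by
    have h := congrArg F.map B.comul_unit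
    rwa [F.map_comp, F.map_tensor] at h
  counit_mul := by
    have h := congrArg F.map B.counit_mul
    rwa [F.map_comp, F.map_tensor] at h
  counit_unit := by
    have h := congrArg F.map B.counit_unit
    rwa [F.map_comp, F.map_id] at h
  comul_mul := by
    have h := congrArg F.map B.comul_mul
    rwa [F.map_comp, F.map_comp, F.map_comp, F.map_tensor, F.map_tensor, F.map_tensor,
      F.map_tensor, F.map_braid, F.map_id] at h

/-- The traced prop `T`, with the bialgebra `B` in it, is the traced prop presented by the
generators and the equations of bicommutative bialgebras. -/
def IsTracedBialgebraProp (T : TracedPROP.{u}) (B : Bialg T.toPROP) : Prop :=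
  ∀ (Q : TracedPROP.{u}) (C : Bialg Q.toPROP),
    ∃! G : TracedFunctor T Q, B.image G.toPROPFunctor = C

/-- The direct sum of two matrices, with block matrix `(A, 0; 0, B)`. -/
def directSum {R : Type u} [Semiring R] {a b c d : ℕ} (A : Matrix (Fin b) (Fin a) R)
    (B : Matrix (Fin d) (Fin c) R) : Matrix (Fin (b + d)) (Fin (a + c)) R :=
  Matrix.reindex finSumFinEquiv finSumFinEquiv (Matrix.fromBlocks A 0 0 B)

/-- The permutation matrix that exchanges the first `a` and the last `b` coordinates, with
block matrix `(0, 1; 1, 0)`. -/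
def swapMatrix (R : Type u) [Semiring R] (a b : ℕ) : Matrix (Fin (b + a)) (Fin (a + b)) R :=
  Matrix.reindex finSumFinEquiv finSumFinEquiv (Matrix.fromBlocks 0 1 1 0)

theorem homCast_matrix {R : Type u} {a a' b b' : ℕ} (ha : a = a') (hb : b = b')
    (A : Matrix (Fin b) (Fin a) R) :
    homCast (H := fun n m => Matrix (Fin m) (Fin n) R) ha hb A =
      A.submatrix (Fin.cast hb.symm) (Fin.cast ha.symm) := by
  subst ha hb
  rfl

theorem cast_castAdd_castAdd {a b c : ℕ} (h : a + b + c = a + (b + c)) (i : Fin a) :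
    Fin.cast h (Fin.castAdd c (Fin.castAdd b i)) = Fin.castAdd (b + c) i :=
  rfl

theorem cast_castAdd_natAdd {a b c : ℕ} (h : a + b + c = a + (b + c)) (i : Fin b) :
    Fin.cast h (Fin.castAdd c (Fin.natAdd a i)) = Fin.natAdd a (Fin.castAdd c i) :=
  rfl

theorem cast_natAdd_add {a b c : ℕ} (h : a + b + c = a + (b + c)) (i : Fin c) :
    Fin.cast h (Fin.natAdd (a + b) i) = Fin.natAdd a (Fin.natAdd b i) := by
  ext
  simp [Nat.add_assoc]

theorem cast_castAdd_add {a b c : ℕ} (h : a + (b + c) = a + b + c) (i : Fin a) :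
    Fin.cast h (Fin.castAdd (b + c) i) = Fin.castAdd c (Fin.castAdd b i) :=
  rfl

theorem cast_natAdd_castAdd {a b c : ℕ} (h : a + (b + c) = a + b + c) (i : Fin b) :
    Fin.cast h (Fin.natAdd a (Fin.castAdd c i)) = Fin.castAdd c (Fin.natAdd a i) :=
  rfl

theorem cast_natAdd_natAdd {a b c : ℕ} (h : a + (b + c) = a + b + c) (i : Fin c) :
    Fin.cast h (Fin.natAdd a (Fin.natAdd b i)) = Fin.natAdd (a + b) i := by
  ext
  simp [Nat.add_assoc]

theorem directSum_swapMatrix_mul {R : Type u} [Semiring R] {a b c d : ℕ}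
    (A : Matrix (Fin ((a + c) + b)) (Fin d) R) :
    directSum (swapMatrix R a c) (1 : Matrix (Fin b) (Fin b) R) * A =
      A.submatrix (Fin.addCases (fun i => Fin.castAdd b (finAddFlip i)) (Fin.natAdd (a + c)))
        _root_.id := by
  ext i j
  rw [Matrix.mul_apply, Fin.sum_univ_add, Fin.sum_univ_add]
  refine Fin.addCases (fun i => Fin.addCases (fun i => ?_) (fun i => ?_) i) (fun i => ?_) i <;>
  simp [directSum, swapMatrix, Matrix.one_apply]

/-- The prop of matrices over `R`: the morphisms `n → m` are the `m × n` matrices, the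
composition is the product, the tensor product is the direct sum. -/
def matPROP (R : Type u) [Semiring R] : PROP.{u} where
  Hom n m := Matrix (Fin m) (Fin n) R
  id _ := 1
  comp A B := A * B
  tensor A B := directSum A B
  braid a b := swapMatrix R a b
  comp_assoc A B C := Matrix.mul_assoc A B C
  id_comp A := Matrix.one_mul A
  comp_id A := Matrix.mul_one A
  tensor_assoc {a b c d e g} A B C := by
    rw [homCast_matrix]
    ext i j
    rw [Matrix.submatrix_apply]
    refine Fin.addCases (fun i => ?_) (fun i => Fin.addCases (fun i => ?_) (fun i => ?_) i) i <;>
    refine Fin.addCases (fun j => ?_) (fun j => Fin.addCases (fun j => ?_) (fun j => ?_) j) j <;>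
    simp only [cast_castAdd_add, cast_natAdd_castAdd, cast_natAdd_natAdd] <;>
    simp [directSum]
  tensor_comp A B C D := by
    simp only [directSum, Matrix.reindex_apply, Matrix.submatrix_mul_equiv,
      Matrix.fromBlocks_multiply, Matrix.zero_mul, Matrix.mul_zero, add_zero, zero_add]
  tensor_id a b := by simp [directSum]
  tensor_empty {a b} A := by
    rw [homCast_matrix]
    ext i j
    rw [Matrix.submatrix_apply]
    exact (congrArg₂ _ (finSumFinEquiv_symm_apply_castAdd i)
      (finSumFinEquiv_symm_apply_castAdd j)).trans
        (Matrix.fromBlocks_apply₁₁ A 0 0 (1 : Matrix (Fin 0) (Fin 0) R) i j)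
  empty_tensor {a b} A := by
    rw [homCast_matrix]
    ext i j
    rw [Matrix.submatrix_apply]
    have h : ∀ {n : ℕ} (i : Fin n), Fin.cast (zero_add n).symm i = Fin.natAdd 0 i := by
      intro n i
      ext
      simp
    rw [h, h]
    exact (congrArg₂ _ (finSumFinEquiv_symm_apply_natAdd i)
      (finSumFinEquiv_symm_apply_natAdd j)).trans
        (Matrix.fromBlocks_apply₂₂ (1 : Matrix (Fin 0) (Fin 0) R) 0 0 A i j)
  braid_braid a b := by
    simp only [swapMatrix, Matrix.reindex_apply, Matrix.submatrix_mul_equiv,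
      Matrix.fromBlocks_multiply, Matrix.zero_mul, Matrix.mul_zero, add_zero, zero_add,
      Matrix.one_mul, Matrix.fromBlocks_one, Matrix.submatrix_one_equiv]
  braid_natural A B := by
    simp only [swapMatrix, directSum, Matrix.reindex_apply, Matrix.submatrix_mul_equiv,
      Matrix.fromBlocks_multiply, Matrix.zero_mul, Matrix.mul_zero, add_zero, zero_add,
      Matrix.one_mul, Matrix.mul_one]
  braid_add a b c := by
    rw [homCast_matrix, homCast_matrix, directSum_swapMatrix_mul]
    ext i j
    simp only [Matrix.submatrix_apply]
    refine Fin.addCases (fun i => ?_) (fun i => Fin.addCases (fun i => ?_) (fun i => ?_) i) i <;>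
    refine Fin.addCases (fun j => Fin.addCases (fun j => ?_) (fun j => ?_) j) (fun j => ?_) j <;>
    simp only [cast_castAdd_add, cast_natAdd_castAdd, cast_natAdd_natAdd, cast_castAdd_castAdd,
      cast_castAdd_natAdd, cast_natAdd_add, Fin.cast_refl,
      _root_.id, Fin.addCases_left, Fin.addCases_right, finAddFlip_apply_castAdd,
      finAddFlip_apply_natAdd] <;>
    simp [directSum, swapMatrix, Matrix.one_apply] <;>
    (intro h; have := congrArg Fin.val h; simp at this; omega)

instance matPROPDecidableEq (a b : ℕ) : DecidableEq ((matPROP ℕ).Hom a b) :=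
  inferInstanceAs (DecidableEq (Matrix (Fin b) (Fin a) ℕ))

/-- The standard bialgebra in the prop of matrices over `ℕ`. -/
def matBialg : Bialg (matPROP ℕ) where
  mul := (!![1, 1] : Matrix (Fin 1) (Fin 2) ℕ)
  unit := (0 : Matrix (Fin 1) (Fin 0) ℕ)
  comul := (!![1; 1] : Matrix (Fin 2) (Fin 1) ℕ)
  counit := (0 : Matrix (Fin 0) (Fin 1) ℕ)
  unit_mul := by decide
  mul_unit := by decide
  mul_assoc := by decide
  mul_comm := (by decide : (!![1, 1] * swapMatrix ℕ 1 1 : Matrix (Fin 1) (Fin 2) ℕ) = !![1, 1])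
  counit_comul := by decide
  comul_counit := by decide
  comul_assoc := by decide
  comul_comm := (by decide : (swapMatrix ℕ 1 1 * !![1; 1] : Matrix (Fin 2) (Fin 1) ℕ) = !![1; 1])
  comul_unit := by decide
  counit_mul := by decide
  counit_unit := by decide
  comul_mul := by decide

/-- The square matrices over `R`, of all sizes. -/
abbrev SquareMatrix (R : Type u) : Type u :=
  Σ n : ℕ, Matrix (Fin n) (Fin n) R

/-- For `M = (a; A)` with first row `a`, the block matrix `(0, 1; A, 0; a, 0)`. -/
def expandMatrix {R : Type u} [Semiring R] {n : ℕ} (M : Matrix (Fin (n + 1)) (Fin (n + 1)) R) :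
    Matrix (Fin (n + 2)) (Fin (n + 2)) R :=
  Matrix.of (Fin.cons (Fin.snoc (fun _ => 0) 1)
    (Fin.snoc (fun i : Fin n => Fin.snoc (M i.succ) 0) (Fin.snoc (M 0) 0)))

/-- The generating moves of PS-equivalence (Parry-Sullivan equivalence). -/
inductive PSStep (R : Type u) [Semiring R] : SquareMatrix R → SquareMatrix R → Prop
  | swap {n m : ℕ} (A : Matrix (Fin n) (Fin m) R) (B : Matrix (Fin m) (Fin n) R) :
      PSStep R ⟨n, A * B⟩ ⟨m, B * A⟩
  | expand {n : ℕ} (M : Matrix (Fin (n + 1)) (Fin (n + 1)) R) :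
      PSStep R ⟨n + 1, M⟩ ⟨n + 2, expandMatrix M⟩

/-- PS-equivalence over `R`: the smallest equivalence relation that contains the moves. -/
def PSEquiv {R : Type u} [Semiring R] {n m : ℕ} (M : Matrix (Fin n) (Fin n) R)
    (N : Matrix (Fin m) (Fin m) R) : Prop :=
  Relation.EqvGen (PSStep R) ⟨n, M⟩ ⟨m, N⟩

/-- Flow equivalence of square matrices of nonnegative integers. -/
abbrev FlowEquiv {n m : ℕ} (M : Matrix (Fin n) (Fin n) ℕ) (N : Matrix (Fin m) (Fin m) ℕ) : Prop :=
  PSEquiv M N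

/-- The formal morphisms of the free traced prop on a family of generators. -/
inductive TracedTerm (G : ℕ → ℕ → Type u) : ℕ → ℕ → Type u
  | gen {a b : ℕ} : G a b → TracedTerm G a b
  | id (a : ℕ) : TracedTerm G a a
  | braid (a b : ℕ) : TracedTerm G (a + b) (b + a)
  | comp {a b c : ℕ} : TracedTerm G b c → TracedTerm G a b → TracedTerm G a c
  | tensor {a b c d : ℕ} : TracedTerm G a b → TracedTerm G c d → TracedTerm G (a + c) (b + d)
  | tr {a b : ℕ} : TracedTerm G (1 + a) (1 + b) → TracedTerm G a b

open TracedTerm in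
/-- The congruence generated by the equations `E` and the axioms of traced props. -/
inductive TracedRel {G : ℕ → ℕ → Type u}
    (E : ∀ a b : ℕ, TracedTerm G a b → TracedTerm G a b → Prop) :
    ∀ a b : ℕ, TracedTerm G a b → TracedTerm G a b → Prop
  | of {a b : ℕ} {f g : TracedTerm G a b} : E a b f g → TracedRel E a b f g
  | refl {a b : ℕ} (f : TracedTerm G a b) : TracedRel E a b f f
  | comp_congr {a b c : ℕ} {f f' : TracedTerm G b c} {g g' : TracedTerm G a b} :
      TracedRel E b c f f' → TracedRel E a b g g' → TracedRel E a c (comp f g) (comp f' g')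
  | tensor_congr {a b c d : ℕ} {f f' : TracedTerm G a b} {g g' : TracedTerm G c d} :
      TracedRel E a b f f' → TracedRel E c d g g' →
        TracedRel E (a + c) (b + d) (tensor f g) (tensor f' g')
  | tr_congr {a b : ℕ} {f f' : TracedTerm G (1 + a) (1 + b)} :
      TracedRel E (1 + a) (1 + b) f f' → TracedRel E a b (tr f) (tr f')
  | comp_assoc {a b c d : ℕ} (f : TracedTerm G c d) (g : TracedTerm G b c)
      (h : TracedTerm G a b) : TracedRel E a d (comp (comp f g) h) (comp f (comp g h))
  | id_comp {a b : ℕ} (f : TracedTerm G a b) : TracedRel E a b (comp (id b) f) f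
  | comp_id {a b : ℕ} (f : TracedTerm G a b) : TracedRel E a b (comp f (id a)) f
  | tensor_assoc {a b c d e g : ℕ} (f : TracedTerm G a b) (h : TracedTerm G c d)
      (k : TracedTerm G e g) :
      TracedRel E (a + (c + e)) (b + (d + g))
        (homCast (Nat.add_assoc a c e) (Nat.add_assoc b d g) (tensor (tensor f h) k))
        (tensor f (tensor h k))
  | tensor_comp {a b c a' b' c' : ℕ} (f : TracedTerm G b c) (g : TracedTerm G a b)
      (h : TracedTerm G b' c') (k : TracedTerm G a' b') :
      TracedRel E (a + a') (c + c') (tensor (comp f g) (comp h k))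
        (comp (tensor f h) (tensor g k))
  | tensor_id (a b : ℕ) : TracedRel E (a + b) (a + b) (tensor (id a) (id b)) (id (a + b))
  | tensor_empty {a b : ℕ} (f : TracedTerm G a b) :
      TracedRel E a b (homCast (Nat.add_zero a) (Nat.add_zero b) (tensor f (id 0))) f
  | empty_tensor {a b : ℕ} (f : TracedTerm G a b) :
      TracedRel E a b (homCast (Nat.zero_add a) (Nat.zero_add b) (tensor (id 0) f)) f
  | braid_braid (a b : ℕ) :
      TracedRel E (a + b) (a + b) (comp (braid b a) (braid a b)) (id (a + b))
  | braid_natural {a b c d : ℕ} (f : TracedTerm G a b) (g : TracedTerm G c d) :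
      TracedRel E (a + c) (d + b) (comp (braid b d) (tensor f g)) (comp (tensor g f) (braid a c))
  | braid_add (a b c : ℕ) :
      TracedRel E (a + b + c) (c + (a + b)) (braid (a + b) c)
        (homCast rfl (Nat.add_assoc c a b)
          (comp (tensor (braid a c) (id b))
            (homCast (Nat.add_assoc a b c).symm (Nat.add_assoc a c b).symm
              (tensor (id a) (braid b c)))))
  | tightening {a b c d : ℕ} (g : TracedTerm G c d) (f : TracedTerm G (1 + b) (1 + c))
      (h : TracedTerm G a b) :
      TracedRel E a d (tr (comp (comp (tensor (id 1) g) f) (tensor (id 1) h)))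
        (comp (comp g (tr f)) h)
  | yanking : TracedRel E 1 1 (tr (braid 1 1)) (id 1)
  | sliding {m n p q : ℕ} (f : TracedTerm G (m + p) (n + q)) (g : TracedTerm G n m) :
      TracedRel E p q (trIter tr n (comp f (tensor g (id p))))
        (trIter tr m (comp (tensor g (id q)) f))
  | strength {a b c d : ℕ} (f : TracedTerm G (1 + a) (1 + b)) (g : TracedTerm G c d) :
      TracedRel E (a + c) (b + d)
        (tr (homCast (Nat.add_assoc 1 a c) (Nat.add_assoc 1 b d) (tensor f g))) (tensor (tr f) g)

theorem map_homCast {H : ℕ → ℕ → Type u} {K : ℕ → ℕ → Type v}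
    (F : ∀ a b : ℕ, H a b → K a b) {a a' b b' : ℕ} (ha : a = a') (hb : b = b') (f : H a b) :
    F a' b' (homCast ha hb f) = homCast ha hb (F a b f) := by
  subst ha hb
  rfl

theorem map_trIter {H : ℕ → ℕ → Type u} {K : ℕ → ℕ → Type v}
    (F : ∀ a b : ℕ, H a b → K a b)
    (tr : ∀ {m n : ℕ}, H (1 + m) (1 + n) → H m n)
    (tr' : ∀ {m n : ℕ}, K (1 + m) (1 + n) → K m n)
    (h : ∀ {m n : ℕ} (f : H (1 + m) (1 + n)), F m n (tr f) = tr' (F _ _ f)) (k : ℕ) :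
    ∀ {m n : ℕ} (f : H (k + m) (k + n)),
      F m n (trIter tr k f) = trIter tr' k (F _ _ f) := by
  induction k with
  | zero =>
    intro m n f
    rw [trIter, trIter]
    exact map_homCast F _ _ f
  | succ k ih =>
    intro m n f
    rw [trIter, trIter, ih, h]
    exact congrArg (fun x => trIter tr' k (tr' x)) (map_homCast F _ _ f)

/-- The traced prop presented by generators `G` and equations `E`. -/
def presentedTracedPROP {G : ℕ → ℕ → Type u}
    (E : ∀ a b : ℕ, TracedTerm G a b → TracedTerm G a b → Prop) : TracedPROP.{u} :=
  let mk : ∀ a b : ℕ, TracedTerm G a b → Quot (TracedRel E a b) := fun _ _ f => Quot.mk _ f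
  let tr : ∀ {a b : ℕ}, Quot (TracedRel E (1 + a) (1 + b)) → Quot (TracedRel E a b) :=
    fun f => Quot.map TracedTerm.tr (fun _ _ h => .tr_congr h) f
  { Hom := fun a b => Quot (TracedRel E a b)
    id := fun a => Quot.mk _ (.id a)
    comp := fun f g => Quot.map₂ TracedTerm.comp (fun x _ _ h => .comp_congr (.refl x) h)
      (fun _ _ y h => .comp_congr h (.refl y)) f g
    tensor := fun f g => Quot.map₂ TracedTerm.tensor (fun x _ _ h => .tensor_congr (.refl x) h)
      (fun _ _ y h => .tensor_congr h (.refl y)) f g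
    braid := fun a b => Quot.mk _ (.braid a b)
    tr := tr
    comp_assoc := by
      rintro a b c d ⟨f⟩ ⟨g⟩ ⟨h⟩
      exact Quot.sound (.comp_assoc f g h)
    id_comp := by
      rintro a b ⟨f⟩
      exact Quot.sound (.id_comp f)
    comp_id := by
      rintro a b ⟨f⟩
      exact Quot.sound (.comp_id f)
    tensor_assoc := by
      rintro a b c d e g ⟨f⟩ ⟨h⟩ ⟨k⟩
      exact (map_homCast (H := TracedTerm G) mk _ _ _).symm.trans (Quot.sound (.tensor_assoc f h k))
    tensor_comp := by
      rintro a b c a' b' c' ⟨f⟩ ⟨g⟩ ⟨h⟩ ⟨k⟩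
      exact Quot.sound (.tensor_comp f g h k)
    tensor_id := fun a b => Quot.sound (.tensor_id a b)
    tensor_empty := by
      rintro a b ⟨f⟩
      exact (map_homCast (H := TracedTerm G) mk _ _ _).symm.trans (Quot.sound (.tensor_empty f))
    empty_tensor := by
      rintro a b ⟨f⟩
      exact (map_homCast (H := TracedTerm G) mk _ _ _).symm.trans (Quot.sound (.empty_tensor f))
    braid_braid := fun a b => Quot.sound (.braid_braid a b)
    braid_natural := by
      rintro a b c d ⟨f⟩ ⟨g⟩
      exact Quot.sound (.braid_natural f g)
    braid_add := fun a b c => by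
      refine (Quot.sound (.braid_add a b c)).trans ((map_homCast (H := TracedTerm G) mk _ _ _).trans ?_)
      refine congrArg (homCast _ _) ?_
      exact congrArg (Quot.map₂ TracedTerm.comp (fun x _ _ h => .comp_congr (.refl x) h)
        (fun _ _ y h => .comp_congr h (.refl y)) (mk _ _ (.tensor (.braid a c) (.id b))))
        (map_homCast (H := TracedTerm G) mk _ _ _)
    tightening := by
      rintro a b c d ⟨g⟩ ⟨f⟩ ⟨h⟩
      exact Quot.sound (.tightening g f h)
    yanking := Quot.sound .yanking
    sliding := by
      rintro m n p q ⟨f⟩ ⟨g⟩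
      exact (map_trIter (H := TracedTerm G) mk TracedTerm.tr tr (fun _ => rfl) n _).symm.trans
        ((Quot.sound (.sliding f g)).trans
          (map_trIter (H := TracedTerm G) mk TracedTerm.tr tr (fun _ => rfl) m _))
    strength := by
      rintro a b c d ⟨f⟩ ⟨g⟩
      exact (congrArg tr (map_homCast (H := TracedTerm G) mk _ _ _)).symm.trans (Quot.sound (.strength f g)) }

/-- The value of a formal morphism in a traced prop, given the values of the generators. -/
def TracedTerm.eval {G : ℕ → ℕ → Type u} (Q : TracedPROP.{v})
    (φ : ∀ {a b : ℕ}, G a b → Q.Hom a b) : ∀ {a b : ℕ}, TracedTerm G a b → Q.Hom a b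
  | _, _, .gen x => φ x
  | _, _, .id a => Q.id a
  | _, _, .braid a b => Q.braid a b
  | _, _, .comp f g => Q.comp (f.eval Q φ) (g.eval Q φ)
  | _, _, .tensor f g => Q.tensor (f.eval Q φ) (g.eval Q φ)
  | _, _, .tr f => Q.tr (f.eval Q φ)

theorem TracedRel.eval_eq {G : ℕ → ℕ → Type u}
    {E : ∀ a b : ℕ, TracedTerm G a b → TracedTerm G a b → Prop} (Q : TracedPROP.{v})
    (φ : ∀ {a b : ℕ}, G a b → Q.Hom a b)
    (hE : ∀ {a b : ℕ} (f g : TracedTerm G a b), E a b f g → f.eval Q φ = g.eval Q φ)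
    {a b : ℕ} {f g : TracedTerm G a b} (h : TracedRel E a b f g) :
    f.eval Q φ = g.eval Q φ := by
  have hc : ∀ {a a' b b' : ℕ} (ha : a = a') (hb : b = b') (f : TracedTerm G a b),
      (homCast ha hb f).eval Q φ = homCast ha hb (f.eval Q φ) :=
    fun ha hb f => map_homCast (H := TracedTerm G) (K := Q.Hom) (fun _ _ => TracedTerm.eval Q φ) ha hb f
  have ht : ∀ (k : ℕ) {m n : ℕ} (f : TracedTerm G (k + m) (k + n)),
      (trIter TracedTerm.tr k f).eval Q φ = trIter Q.tr k (f.eval Q φ) :=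
    fun k _ _ f => map_trIter (H := TracedTerm G) (K := Q.Hom) (fun _ _ => TracedTerm.eval Q φ) TracedTerm.tr Q.tr
      (fun _ => by rw [TracedTerm.eval]) k f
  induction h with
  | of h => exact hE _ _ h
  | refl f => rfl
  | comp_congr _ _ h1 h2 => simp only [TracedTerm.eval, h1, h2]
  | tensor_congr _ _ h1 h2 => simp only [TracedTerm.eval, h1, h2]
  | tr_congr _ h => simp only [TracedTerm.eval, h]
  | comp_assoc f g h => simp only [TracedTerm.eval, Q.comp_assoc]
  | id_comp f => simp only [TracedTerm.eval, Q.id_comp]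
  | comp_id f => simp only [TracedTerm.eval, Q.comp_id]
  | tensor_assoc f h k => rw [hc]; simp only [TracedTerm.eval, Q.tensor_assoc]
  | tensor_comp f g h k => simp only [TracedTerm.eval, Q.tensor_comp]
  | tensor_id a b => simp only [TracedTerm.eval, Q.tensor_id]
  | tensor_empty f => rw [hc]; simp only [TracedTerm.eval, Q.tensor_empty]
  | empty_tensor f => rw [hc]; simp only [TracedTerm.eval, Q.empty_tensor]
  | braid_braid a b => simp only [TracedTerm.eval, Q.braid_braid]
  | braid_natural f g => simp only [TracedTerm.eval, Q.braid_natural]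
  | braid_add a b c => rw [hc]; simp only [TracedTerm.eval, hc]; exact Q.braid_add a b c
  | tightening g f h => simp only [TracedTerm.eval, Q.tightening]
  | yanking => simp only [TracedTerm.eval, Q.yanking]
  | sliding f g => rw [ht, ht]; simp only [TracedTerm.eval]; exact Q.sliding _ _
  | strength f g => simp only [TracedTerm.eval, hc]; exact Q.strength _ _

theorem existsUnique_presentedTracedPROP {G : ℕ → ℕ → Type u}
    (E : ∀ a b : ℕ, TracedTerm G a b → TracedTerm G a b → Prop) (Q : TracedPROP.{v})
    (φ : ∀ {a b : ℕ}, G a b → Q.Hom a b)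
    (hE : ∀ {a b : ℕ} (f g : TracedTerm G a b), E a b f g → f.eval Q φ = g.eval Q φ) :
    ∃! F : TracedFunctor (presentedTracedPROP E) Q,
      ∀ {a b : ℕ} (x : G a b), F.map (Quot.mk _ (.gen x)) = φ x := by
  refine ⟨{ map := fun f => Quot.lift (TracedTerm.eval Q φ) (fun _ _ h => h.eval_eq Q φ hE) f
            map_id := fun a => by simp only [presentedTracedPROP, TracedTerm.eval]
            map_comp := ?_
            map_tensor := ?_
            map_braid := fun a b => by simp only [presentedTracedPROP, TracedTerm.eval]
            map_tr := ?_ }, ?_, ?_⟩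
  · rintro a b c ⟨f⟩ ⟨g⟩
    exact TracedTerm.eval.eq_4 _ _ _ _ _ _ _
  · rintro a b c d ⟨f⟩ ⟨g⟩
    exact TracedTerm.eval.eq_5 _ _ _ _ _ _ _ _
  · rintro a b ⟨f⟩
    exact TracedTerm.eval.eq_6 _ _ _ _ _
  · intro a b x
    exact TracedTerm.eval.eq_1 _ _ _ _ _
  · intro F hF
    have key : ∀ {a b : ℕ} (f : TracedTerm G a b), F.map (Quot.mk _ f) = f.eval Q φ := by
      intro a b f
      induction f with
      | gen x => rw [hF, TracedTerm.eval]
      | id a => exact (F.map_id a).trans (by rw [TracedTerm.eval])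
      | braid a b => exact (F.map_braid a b).trans (by rw [TracedTerm.eval])
      | comp f g hf hg =>
        rw [TracedTerm.eval, ← hf, ← hg]
        exact F.map_comp (Quot.mk _ f) (Quot.mk _ g)
      | tensor f g hf hg =>
        rw [TracedTerm.eval, ← hf, ← hg]
        exact F.map_tensor (Quot.mk _ f) (Quot.mk _ g)
      | tr f hf =>
        rw [TracedTerm.eval, ← hf]
        exact F.map_tr (Quot.mk _ f)
    ext a b ⟨f⟩
    exact key f

/-- The equations that make `x ↦ gen x` a prop functor. -/
inductive FunctorRel (P : PROP.{u}) :
    ∀ a b : ℕ, TracedTerm P.Hom a b → TracedTerm P.Hom a b → Prop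
  | id (a : ℕ) : FunctorRel P a a (.gen (P.id a)) (.id a)
  | comp {a b c : ℕ} (f : P.Hom b c) (g : P.Hom a b) :
      FunctorRel P a c (.gen (P.comp f g)) (.comp (.gen f) (.gen g))
  | tensor {a b c d : ℕ} (f : P.Hom a b) (g : P.Hom c d) :
      FunctorRel P (a + c) (b + d) (.gen (P.tensor f g)) (.tensor (.gen f) (.gen g))
  | braid (a b : ℕ) : FunctorRel P (a + b) (b + a) (.gen (P.braid a b)) (.braid a b)

/-- Every prop has a traced completion. -/
theorem exists_isTracedCompletion (P : PROP.{u}) :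
    ∃ (T : TracedPROP.{u}) (ι : PROPFunctor P T.toPROP), IsTracedCompletion T ι := by
  refine ⟨presentedTracedPROP (FunctorRel P),
    { map := fun f => Quot.mk _ (.gen f)
      map_id := fun a => Quot.sound (.of (.id a))
      map_comp := fun f g => Quot.sound (.of (.comp f g))
      map_tensor := fun f g => Quot.sound (.of (.tensor f g))
      map_braid := fun a b => Quot.sound (.of (.braid a b)) }, ?_⟩
  intro Q η
  obtain ⟨F, hF, hu⟩ := existsUnique_presentedTracedPROP (FunctorRel P) Q η.map (by
    rintro a b f g (_ | ⟨f, g⟩ | ⟨f, g⟩ | _)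
    · simp only [TracedTerm.eval, η.map_id]
    · simp only [TracedTerm.eval, η.map_comp]
    · simp only [TracedTerm.eval, η.map_tensor]
    · simp only [TracedTerm.eval, η.map_braid])
  refine ⟨F, ?_, ?_⟩
  · ext a b x
    exact hF x
  · intro F' hF'
    refine hu F' ?_
    intro a b x
    rw [← hF']
    rfl

/-- The generators of bialgebras. -/
inductive BialgGen : ℕ → ℕ → Type u
  | mul : BialgGen 2 1
  | unit : BialgGen 0 1
  | comul : BialgGen 1 2
  | counit : BialgGen 1 0

open TracedTerm BialgGen in
/-- The equations of bicommutative bialgebras. -/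
inductive BialgRel :
    ∀ a b : ℕ, TracedTerm BialgGen.{u} a b → TracedTerm BialgGen.{u} a b → Prop
  | unit_mul : BialgRel 1 1 (comp (b := 2) (gen mul) (tensor (gen unit) (id 1))) (id 1)
  | mul_unit : BialgRel 1 1 (comp (b := 2) (gen mul) (tensor (id 1) (gen unit))) (id 1)
  | mul_assoc : BialgRel 3 1 (comp (b := 2) (gen mul) (tensor (gen mul) (id 1)))
      (comp (b := 2) (gen mul) (tensor (id 1) (gen mul)))
  | mul_comm : BialgRel 2 1 (comp (b := 2) (gen mul) (braid 1 1)) (gen mul)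
  | counit_comul : BialgRel 1 1 (comp (b := 1 + 1) (tensor (gen counit) (id 1)) (gen comul)) (id 1)
  | comul_counit : BialgRel 1 1 (comp (b := 1 + 1) (tensor (id 1) (gen counit)) (gen comul)) (id 1)
  | comul_assoc : BialgRel 1 3 (comp (b := 1 + 1) (tensor (gen comul) (id 1)) (gen comul))
      (comp (b := 1 + 1) (tensor (id 1) (gen comul)) (gen comul))
  | comul_comm : BialgRel 1 2 (comp (b := 1 + 1) (braid 1 1) (gen comul)) (gen comul)
  | comul_unit : BialgRel 0 2 (comp (gen comul) (gen unit)) (tensor (gen unit) (gen unit))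
  | counit_mul : BialgRel 2 0 (comp (gen counit) (gen mul)) (tensor (gen counit) (gen counit))
  | counit_unit : BialgRel 0 0 (comp (gen counit) (gen unit)) (id 0)
  | comul_mul : BialgRel 2 2
      (comp (a := 2) (b := 4) (c := 2)
        (comp (a := 4) (b := 4) (c := 2) (tensor (gen mul) (gen mul))
          (tensor (b := 1 + (1 + 1)) (tensor (id 1) (braid 1 1)) (id 1)))
        (tensor (gen comul) (gen comul))) (comp (gen comul) (gen mul))

/-- The traced prop presented by the generators and equations of bialgebras exists. -/
theorem exists_isTracedBialgebraProp :
    ∃ (T : TracedPROP.{u}) (B : Bialg T.toPROP), IsTracedBialgebraProp T B := by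
  refine ⟨presentedTracedPROP BialgRel.{u},
    { mul := Quot.mk _ (.gen .mul)
      unit := Quot.mk _ (.gen .unit)
      comul := Quot.mk _ (.gen .comul)
      counit := Quot.mk _ (.gen .counit)
      unit_mul := Quot.sound (.of .unit_mul)
      mul_unit := Quot.sound (.of .mul_unit)
      mul_assoc := Quot.sound (.of .mul_assoc)
      mul_comm := Quot.sound (.of .mul_comm)
      counit_comul := Quot.sound (.of .counit_comul)
      comul_counit := Quot.sound (.of .comul_counit)
      comul_assoc := Quot.sound (.of .comul_assoc)
      comul_comm := Quot.sound (.of .comul_comm)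
      comul_unit := Quot.sound (.of .comul_unit)
      counit_mul := Quot.sound (.of .counit_mul)
      counit_unit := Quot.sound (.of .counit_unit)
      comul_mul := Quot.sound (.of .comul_mul) }, ?_⟩
  intro Q C
  let φ : ∀ {a b : ℕ}, BialgGen.{u} a b → Q.Hom a b := fun x =>
    match x with
    | .mul => C.mul
    | .unit => C.unit
    | .comul => C.comul
    | .counit => C.counit
  obtain ⟨F, hF, hu⟩ := existsUnique_presentedTracedPROP BialgRel.{u} Q φ (by
    intro a b f g h
    cases h
    · exact C.unit_mul
    · exact C.mul_unit
    · exact C.mul_assoc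
    · exact C.mul_comm
    · exact C.counit_comul
    · exact C.comul_counit
    · exact C.comul_assoc
    · exact C.comul_comm
    · exact C.comul_unit
    · exact C.counit_mul
    · exact C.counit_unit
    · exact C.comul_mul)
  refine ⟨F, Bialg.ext (hF .mul) (hF .unit) (hF .comul) (hF .counit), ?_⟩
  intro F' hF'
  refine hu F' ?_
  intro a b x
  cases x
  · exact congrArg Bialg.mul hF'
  · exact congrArg Bialg.unit hF'
  · exact congrArg Bialg.comul hF'
  · exact congrArg Bialg.counit hF'

/-- Matrices over `R` with inputs `I` and outputs `O` and a finite set of states, which are both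
inputs and outputs. -/
abbrev OpenMatrixRep (R : Type u) (I O : Type) : Type u :=
  Σ k : ℕ, Matrix (Fin k ⊕ O) (Fin k ⊕ I) R

/-- `M` arises from `N` by the elimination of the states in `J`, which have no edges between
them. -/
def EliminatesTo {R : Type u} [Semiring R] {I O X Y J : Type} [Fintype J] (e : X ⊕ J ≃ Y)
    (N : Matrix (Y ⊕ O) (Y ⊕ I) R) (M : Matrix (X ⊕ O) (X ⊕ I) R) : Prop :=
  (∀ j j', N (.inl (e (.inr j))) (.inl (e (.inr j'))) = 0) ∧
  ∀ o i, M o i = N (Sum.map (fun x => e (.inl x)) id o) (Sum.map (fun x => e (.inl x)) id i) +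
    ∑ j, N (Sum.map (fun x => e (.inl x)) id o) (.inl (e (.inr j))) *
      N (.inl (e (.inr j))) (Sum.map (fun x => e (.inl x)) id i)

/-- The elimination of states, as a relation. -/
inductive OpenMatrixStep (R : Type u) [Semiring R] (I O : Type) :
    OpenMatrixRep R I O → OpenMatrixRep R I O → Prop
  | mk {k l j : ℕ} (e : Fin k ⊕ Fin j ≃ Fin l) {N : Matrix (Fin l ⊕ O) (Fin l ⊕ I) R}
      {M : Matrix (Fin k ⊕ O) (Fin k ⊕ I) R} (h : EliminatesTo e N M) :
      OpenMatrixStep R I O ⟨l, N⟩ ⟨k, M⟩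

/-- Open matrices up to the elimination of states. -/
def OpenMatrix (R : Type u) [Semiring R] (I O : Type) : Type u :=
  Quot (OpenMatrixStep R I O)

namespace OpenMatrix

variable {R : Type u} [Semiring R] {I O I' O' X Y J A B : Type}

/-- The open matrix with an arbitrary finite set of states. -/
noncomputable def mk (X : Type) [Fintype X] (M : Matrix (X ⊕ O) (X ⊕ I) R) : OpenMatrix R I O :=
  Quot.mk _ ⟨Fintype.card X, M.submatrix (Sum.map (Fintype.equivFin X).symm id)
    (Sum.map (Fintype.equivFin X).symm id)⟩

theorem mk_eq [Fintype X] [Fintype Y] [Fintype J] (e : X ⊕ J ≃ Y)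
    {N : Matrix (Y ⊕ O) (Y ⊕ I) R} {M : Matrix (X ⊕ O) (X ⊕ I) R} (h : EliminatesTo e N M) :
    mk Y N = mk X M := by
  refine Quot.sound (.mk (((Fintype.equivFin X).symm.sumCongr (Fintype.equivFin J).symm).trans
    (e.trans (Fintype.equivFin Y))) ⟨?_, ?_⟩)
  · intro j j'
    simpa using h.1 _ _
  · intro o i
    have key : ∀ {Z : Type} (z : Fin (Fintype.card X) ⊕ Z), (Sum.map (Fintype.equivFin Y).symm id
        (Sum.map (fun x => (((Fintype.equivFin X).symm.sumCongr (Fintype.equivFin J).symm).trans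
          (e.trans (Fintype.equivFin Y))) (.inl x)) id z)) =
        Sum.map (fun x => e (.inl x)) id (Sum.map (Fintype.equivFin X).symm id z) := by
      rintro Z (z | z) <;> simp
    rw [Matrix.submatrix_apply, h.2, ← (Fintype.equivFin J).symm.sum_comp]
    simp only [Matrix.submatrix_apply, key]
    simp

theorem mk_equiv [Fintype X] [Fintype Y] (e : X ≃ Y)
    {N : Matrix (Y ⊕ O) (Y ⊕ I) R} {M : Matrix (X ⊕ O) (X ⊕ I) R}
    (h : ∀ o i, M o i = N (Sum.map e id o) (Sum.map e id i)) : mk Y N = mk X M :=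
  mk_eq (J := Fin 0) ((Equiv.sumEmpty X (Fin 0)).trans e)
    ⟨fun j => j.elim0, fun o i => by simpa using h o i⟩

theorem mk_fin {k : ℕ} (M : Matrix (Fin k ⊕ O) (Fin k ⊕ I) R) :
    mk (Fin k) M = Quot.mk _ ⟨k, M⟩ := by
  refine Quot.sound (.mk (j := 0) ((Equiv.sumEmpty _ _).trans (Fintype.equivFin (Fin k)))
    ⟨fun j => j.elim0, fun o i => ?_⟩)
  have key : ∀ {Z : Type} (z : Fin k ⊕ Z), (Sum.map (Fintype.equivFin (Fin k)).symm id
        (Sum.map (fun x => (((Equiv.sumEmpty _ (Fin 0)).trans (Fintype.equivFin (Fin k)))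
          (.inl x))) id z)) = z := by
      rintro Z (z | z) <;> simp
  simp [Matrix.submatrix_apply]

theorem exists_mk (f : OpenMatrix R I O) :
    ∃ (k : ℕ) (M : Matrix (Fin k ⊕ O) (Fin k ⊕ I) R), f = mk (Fin k) M := by
  obtain ⟨k, M⟩ := f
  exact ⟨k, M, (mk_fin M).symm⟩

/-- Functions on open matrices. -/
def lift {α : Sort*} (F : ∀ k : ℕ, Matrix (Fin k ⊕ O) (Fin k ⊕ I) R → α)
    (hF : ∀ {k l j : ℕ} (e : Fin k ⊕ Fin j ≃ Fin l) {N : Matrix (Fin l ⊕ O) (Fin l ⊕ I) R}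
      {M : Matrix (Fin k ⊕ O) (Fin k ⊕ I) R}, EliminatesTo e N M → F l N = F k M)
    (f : OpenMatrix R I O) : α :=
  Quot.lift (fun M => F M.1 M.2) (by rintro _ _ ⟨e, h⟩; exact hF e h) f

/-- Change of the inputs and the outputs along functions. -/
def rewire (p : I' → I) (q : O' → O) : OpenMatrix R I O → OpenMatrix R I' O' :=
  lift (fun k M => Quot.mk _ ⟨k, M.submatrix (Sum.map id q) (Sum.map id p)⟩) (by
    intro k l j e N M h
    refine Quot.sound (.mk e ⟨h.1, ?_⟩)
    rintro (o | o) (i | i) <;> exact h.2 _ _)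

theorem rewire_mk [Fintype X] (p : I' → I) (q : O' → O) (M : Matrix (X ⊕ O) (X ⊕ I) R) :
    rewire p q (mk X M) = mk X (M.submatrix (Sum.map id q) (Sum.map id p)) := by
  refine congrArg (Quot.mk _) (congrArg (Sigma.mk _) ?_)
  ext (o | o) (i | i) <;> rfl

/-- The trace. -/
noncomputable def trace (A : Type) [Fintype A] : OpenMatrix R (A ⊕ I) (A ⊕ O) → OpenMatrix R I O :=
  lift (fun k M => mk (Fin k ⊕ A) (M.submatrix (Equiv.sumAssoc _ _ _) (Equiv.sumAssoc _ _ _))) (by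
    intro k l j e N M h
    refine mk_eq (J := Fin j) ((Equiv.sumAssoc _ _ _).trans (((Equiv.refl _).sumCongr
      (Equiv.sumComm _ _)).trans ((Equiv.sumAssoc _ _ _).symm.trans
        (e.sumCongr (Equiv.refl _))))) ⟨?_, ?_⟩
    · intro j j'
      exact h.1 _ _
    · rintro ((o | o) | o) ((i | i) | i) <;> exact h.2 _ _)

theorem trace_mk [Fintype A] [Fintype X] (M : Matrix (X ⊕ (A ⊕ O)) (X ⊕ (A ⊕ I)) R) :
    trace A (mk X M) =
      mk (X ⊕ A) (M.submatrix (Equiv.sumAssoc _ _ _) (Equiv.sumAssoc _ _ _)) := by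
  refine mk_equiv ((Fintype.equivFin X).sumCongr (Equiv.refl _)) ?_
  rintro ((o | o) | o) ((i | i) | i) <;> simp

/-- The direct sum. -/
noncomputable def tensor (f : OpenMatrix R I O) (g : OpenMatrix R I' O') :
    OpenMatrix R (I ⊕ I') (O ⊕ O') :=
  lift (fun k M => lift (fun l N => mk (Fin k ⊕ Fin l)
    ((Matrix.fromBlocks M 0 0 N).submatrix (Equiv.sumSumSumComm _ _ _ _)
      (Equiv.sumSumSumComm _ _ _ _))) (by
    intro k' l j e N N' h
    refine mk_eq (J := Fin j) ((Equiv.sumAssoc _ _ _).trans ((Equiv.refl _).sumCongr e)) ⟨?_, ?_⟩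
    · intro j j'
      exact h.1 _ _
    · rintro ((o | o) | (o | o)) ((i | i) | (i | i)) <;> 
      first | exact h.2 _ _ | simp) g) (by
    intro k l j e N M h
    obtain ⟨k', g, rfl⟩ := exists_mk g
    rw [mk_fin]
    refine mk_eq (J := Fin j) ((Equiv.sumAssoc _ _ _).trans (((Equiv.refl _).sumCongr
      (Equiv.sumComm _ _)).trans ((Equiv.sumAssoc _ _ _).symm.trans
        (e.sumCongr (Equiv.refl _))))) ⟨?_, ?_⟩
    · intro j j'
      exact h.1 _ _
    · rintro ((o | o) | (o | o)) ((i | i) | (i | i)) <;> 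
      first | exact h.2 _ _ | simp) f

theorem tensor_mk [Fintype X] [Fintype Y] (M : Matrix (X ⊕ O) (X ⊕ I) R)
    (N : Matrix (Y ⊕ O') (Y ⊕ I') R) : tensor (mk X M) (mk Y N) =
      mk (X ⊕ Y) ((Matrix.fromBlocks M 0 0 N).submatrix (Equiv.sumSumSumComm _ _ _ _)
      (Equiv.sumSumSumComm _ _ _ _)) := by
  refine mk_equiv ((Fintype.equivFin X).sumCongr (Fintype.equivFin Y)) ?_
  rintro ((o | o) | (o | o)) ((i | i) | (i | i)) <;> simp

/-- The open matrix of a matrix. -/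
noncomputable def ofMatrix (M : Matrix O I R) : OpenMatrix R I O :=
  mk Empty (M.submatrix (Equiv.emptySum _ _) (Equiv.emptySum _ _))

/-- The composition, which routes the wires of `J` through states. -/
noncomputable def comp [Fintype J] (f : OpenMatrix R J O) (g : OpenMatrix R I J) :
    OpenMatrix R I O :=
  trace J (rewire id Sum.swap (tensor f g))

theorem comp_mk [Fintype X] [Fintype Y] [Fintype J] (M : Matrix (X ⊕ O) (X ⊕ J) R)
    (N : Matrix (Y ⊕ J) (Y ⊕ I) R) : comp (mk X M) (mk Y N) =
      mk ((X ⊕ Y) ⊕ J) ((Matrix.fromBlocks M 0 0 N).submatrix 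
        (fun z => Equiv.sumSumSumComm _ _ _ _ (Sum.map id Sum.swap (Equiv.sumAssoc _ _ _ z)))
        (fun z => Equiv.sumSumSumComm _ _ _ _ (Equiv.sumAssoc _ _ _ z))) := by
  rw [comp, tensor_mk, rewire_mk, trace_mk]
  refine congrArg (mk _) ?_
  ext (((o | o) | o) | o) (((i | i) | i) | i) <;> rfl

/-! ### Laws for open matrices -/

theorem rewire_rewire {I'' O'' : Type} (p : I' → I) (q : O' → O) (p' : I'' → I') (q' : O'' → O')
    (f : OpenMatrix R I O) : rewire p' q' (rewire p q f) = rewire (p ∘ p') (q ∘ q') f := by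
  obtain ⟨k, M, rfl⟩ := exists_mk f
  rw [rewire_mk, rewire_mk, rewire_mk]
  refine congrArg (mk _) ?_
  ext (o | o) (i | i) <;> rfl

theorem rewire_id (f : OpenMatrix R I O) : rewire id id f = f := by
  obtain ⟨k, M, rfl⟩ := exists_mk f
  rw [rewire_mk]
  refine congrArg (mk _) ?_
  ext (o | o) (i | i) <;> rfl

theorem tensor_rewire {I₁ O₁ I₁' O₁' : Type} (p : I₁ → I) (q : O₁ → O) (p' : I₁' → I')
    (q' : O₁' → O') (f : OpenMatrix R I O) (g : OpenMatrix R I' O') :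
    tensor (rewire p q f) (rewire p' q' g) =
      rewire (Sum.map p p') (Sum.map q q') (tensor f g) := by
  obtain ⟨k, M, rfl⟩ := exists_mk f
  obtain ⟨l, N, rfl⟩ := exists_mk g
  rw [rewire_mk, rewire_mk, tensor_mk, tensor_mk, rewire_mk]
  refine congrArg (mk _) ?_
  ext ((o | o) | (o | o)) ((i | i) | (i | i)) <;> rfl

theorem comp_rewire [Fintype J] (q : O' → O) (p : I' → I) (f : OpenMatrix R J O)
    (g : OpenMatrix R I J) :
    comp (rewire id q f) (rewire p id g) = rewire p q (comp f g) := by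
  obtain ⟨k, M, rfl⟩ := exists_mk f
  obtain ⟨l, N, rfl⟩ := exists_mk g
  rw [rewire_mk, rewire_mk, comp_mk, comp_mk, rewire_mk]
  refine congrArg (mk _) ?_
  ext (((o | o) | o) | o) (((i | i) | i) | i) <;> rfl

theorem comp_rewire_middle [Fintype J] [Fintype A] (e : A ≃ J) (f : OpenMatrix R J O)
    (g : OpenMatrix R I J) :
    comp (rewire e id f) (rewire id e g) = comp f g := by
  obtain ⟨k, M, rfl⟩ := exists_mk f
  obtain ⟨l, N, rfl⟩ := exists_mk g
  rw [rewire_mk, rewire_mk, comp_mk, comp_mk]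
  refine (mk_equiv ((Equiv.refl _).sumCongr e) ?_).symm
  rintro (((o | o) | o) | o) (((i | i) | i) | i) <;> rfl

theorem tensor_assoc {I₁ O₁ I₂ O₂ I₃ O₃ : Type} (f : OpenMatrix R I₁ O₁) (g : OpenMatrix R I₂ O₂)
    (h : OpenMatrix R I₃ O₃) :
    tensor (tensor f g) h = rewire (Equiv.sumAssoc _ _ _) (Equiv.sumAssoc _ _ _)
      (tensor f (tensor g h)) := by
  obtain ⟨k₁, M₁, rfl⟩ := exists_mk f
  obtain ⟨k₂, M₂, rfl⟩ := exists_mk g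
  obtain ⟨k₃, M₃, rfl⟩ := exists_mk h
  rw [tensor_mk, tensor_mk, tensor_mk, tensor_mk, rewire_mk]
  refine mk_equiv (Equiv.sumAssoc _ _ _).symm ?_
  rintro ((o | o | o) | ((o | o) | o)) ((i | i | i) | ((i | i) | i)) <;> rfl

theorem comp_assoc {A B : Type} [Fintype A] [Fintype B] (f : OpenMatrix R B O)
    (g : OpenMatrix R A B) (h : OpenMatrix R I A) : comp (comp f g) h = comp f (comp g h) := by
  obtain ⟨k₁, M₁, rfl⟩ := exists_mk f
  obtain ⟨k₂, M₂, rfl⟩ := exists_mk g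
  obtain ⟨k₃, M₃, rfl⟩ := exists_mk h
  simp only [comp_mk]
  refine mk_equiv (X := ((Fin k₁ ⊕ ((Fin k₂ ⊕ Fin k₃) ⊕ A)) ⊕ B))
    (Y := ((((Fin k₁ ⊕ Fin k₂) ⊕ B) ⊕ Fin k₃) ⊕ A))
    ⟨fun | .inl (.inl x) => .inl (.inl (.inl (.inl x)))
         | .inl (.inr (.inl (.inl x))) => .inl (.inl (.inl (.inr x)))
         | .inl (.inr (.inl (.inr x))) => .inl (.inr x)
         | .inl (.inr (.inr x)) => .inr x
         | .inr x => .inl (.inl (.inr x)),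
     fun | .inl (.inl (.inl (.inl x))) => .inl (.inl x)
         | .inl (.inl (.inl (.inr x))) => .inl (.inr (.inl (.inl x)))
         | .inl (.inr x) => .inl (.inr (.inl (.inr x)))
         | .inr x => .inl (.inr (.inr x))
         | .inl (.inl (.inr x)) => .inr x,
     by rintro ((_ | ((_ | _) | _)) | _) <;> rfl, 
     by rintro ((((_ | _) | _) | _) | _) <;> rfl⟩ ?_
  rintro (((o | ((o | o) | o)) | o) | o) (((i | ((i | i) | i)) | i) | i) <;> rfl

theorem tensor_comp {I₁ O₁ I₂ O₂ A B : Type} [Fintype A] [Fintype B] (f : OpenMatrix R A O₁)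
    (g : OpenMatrix R I₁ A) (h : OpenMatrix R B O₂) (k : OpenMatrix R I₂ B) :
    tensor (comp f g) (comp h k) = comp (tensor f h) (tensor g k) := by
  obtain ⟨k₁, M₁, rfl⟩ := exists_mk f
  obtain ⟨k₂, M₂, rfl⟩ := exists_mk g
  obtain ⟨k₃, M₃, rfl⟩ := exists_mk h
  obtain ⟨k₄, M₄, rfl⟩ := exists_mk k
  simp only [comp_mk, tensor_mk]
  refine mk_equiv (((Equiv.sumSumSumComm _ _ _ _).sumCongr (Equiv.refl _)).trans
    (Equiv.sumSumSumComm _ _ _ _)) ?_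
  rintro ((((o | o) | (o | o)) | (o | o)) | (o | o))
    ((((i | i) | (i | i)) | (i | i)) | (i | i)) <;> rfl

end OpenMatrix

namespace OpenMatrix

variable {R : Type u} [Semiring R] {I O I' O' X Y J A B : Type}

theorem rewire_ofMatrix (p : I' → I) (q : O' → O) (M : Matrix O I R) :
    rewire p q (ofMatrix M) = ofMatrix (M.submatrix q p) := by
  rw [ofMatrix, rewire_mk]
  refine congrArg (mk _) ?_
  ext (o | o) (i | i) <;> first | exact o.elim | exact i.elim | rfl

theorem tensor_ofMatrix (M : Matrix O I R) (N : Matrix O' I' R) :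
    tensor (ofMatrix M) (ofMatrix N) = ofMatrix (Matrix.fromBlocks M 0 0 N) := by
  rw [ofMatrix, ofMatrix, tensor_mk]
  refine (mk_equiv (Equiv.sumEmpty _ _) ?_).symm
  rintro ((o | o) | (o | o)) ((i | i) | (i | i)) <;>
  first | exact o.elim | exact i.elim | rfl

theorem tensor_swap (f : OpenMatrix R I O) (g : OpenMatrix R I' O') :
    tensor g f = rewire Sum.swap Sum.swap (tensor f g) := by
  obtain ⟨k, M, rfl⟩ := exists_mk f
  obtain ⟨l, N, rfl⟩ := exists_mk g
  rw [tensor_mk, tensor_mk, rewire_mk]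
  refine mk_equiv (Equiv.sumComm _ _) ?_
  rintro ((o | o) | (o | o)) ((i | i) | (i | i)) <;> rfl

theorem tensor_empty [IsEmpty I'] [IsEmpty O'] (f : OpenMatrix R I O) (M : Matrix O' I' R) :
    rewire Sum.inl Sum.inl (tensor f (ofMatrix M)) = f := by
  obtain ⟨k, N, rfl⟩ := exists_mk f
  rw [ofMatrix, tensor_mk, rewire_mk]
  refine (mk_equiv (Equiv.sumEmpty _ _) ?_).symm
  rintro ((o | o) | o) ((i | i) | i) <;> first | exact o.elim | exact i.elim | rfl

theorem comp_ofMatrix [Fintype J] (M : Matrix O J R) (N : Matrix J I R) :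
    comp (ofMatrix M) (ofMatrix N) = ofMatrix (M * N) := by
  rw [ofMatrix, ofMatrix, comp_mk]
  refine mk_eq (((Equiv.emptySum Empty Empty).symm).sumCongr (Equiv.refl J)) ⟨?_, ?_⟩
  · intro j j'
    rfl
  · rintro (o | o) (i | i)
    · exact o.elim
    · exact o.elim
    · exact i.elim
    · simp [Matrix.mul_apply]

theorem ofMatrix_one_comp [Fintype J] [DecidableEq J] (f : OpenMatrix R I J) :
    comp (ofMatrix (1 : Matrix J J R)) f = f := by
  obtain ⟨k, N, rfl⟩ := exists_mk f
  rw [ofMatrix, comp_mk]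
  refine mk_eq (((Equiv.emptySum Empty _).symm).sumCongr (Equiv.refl J)) ⟨?_, ?_⟩
  · intro j j'
    rfl
  · rintro (o | o) (i | i) <;> simp [Matrix.one_apply]

theorem comp_ofMatrix_one [Fintype J] [DecidableEq J] (f : OpenMatrix R J O) :
    comp f (ofMatrix (1 : Matrix J J R)) = f := by
  obtain ⟨k, N, rfl⟩ := exists_mk f
  rw [ofMatrix, comp_mk]
  refine mk_eq (((Equiv.sumEmpty _ Empty).symm).sumCongr (Equiv.refl J)) ⟨?_, ?_⟩
  · intro j j'
    rfl
  · rintro (o | o) (i | i) <;> simp [Matrix.one_apply]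

theorem trace_rewire [Fintype A] (p : I' → I) (q : O' → O)
    (f : OpenMatrix R (A ⊕ I) (A ⊕ O)) :
    trace A (rewire (Sum.map id p) (Sum.map id q) f) = rewire p q (trace A f) := by
  obtain ⟨k, N, rfl⟩ := exists_mk f
  rw [rewire_mk, trace_mk, trace_mk, rewire_mk]
  refine congrArg (mk _) ?_
  ext ((o | o) | o) ((i | i) | i) <;> rfl

theorem trace_rewire_equiv [Fintype A] [Fintype B] (e : A ≃ B)
    (f : OpenMatrix R (B ⊕ I) (B ⊕ O)) :
    trace A (rewire (Sum.map e id) (Sum.map e id) f) = trace B f := by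
  obtain ⟨k, N, rfl⟩ := exists_mk f
  rw [rewire_mk, trace_mk, trace_mk]
  refine (mk_equiv ((Equiv.refl _).sumCongr e) ?_).symm
  rintro ((o | o) | o) ((i | i) | i) <;> rfl

theorem trace_trace [Fintype A] [Fintype B] (f : OpenMatrix R (A ⊕ (B ⊕ I)) (A ⊕ (B ⊕ O))) :
    trace B (trace A f) =
      trace (A ⊕ B) (rewire (Equiv.sumAssoc _ _ _) (Equiv.sumAssoc _ _ _) f) := by
  obtain ⟨k, N, rfl⟩ := exists_mk f
  rw [rewire_mk, trace_mk, trace_mk, trace_mk]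
  refine (mk_equiv (Equiv.sumAssoc _ _ _) ?_).symm
  rintro (((o | o) | o) | o) (((i | i) | i) | i) <;> rfl

theorem trace_empty [Fintype A] [IsEmpty A] (f : OpenMatrix R (A ⊕ I) (A ⊕ O)) :
    trace A f = rewire Sum.inr Sum.inr f := by
  obtain ⟨k, N, rfl⟩ := exists_mk f
  rw [trace_mk, rewire_mk]
  refine mk_equiv (Equiv.sumEmpty _ _).symm ?_
  rintro (o | o) (i | i) <;> rfl

theorem trace_tensor_comp [Fintype A] [DecidableEq A] [Fintype J] (g : OpenMatrix R J O)
    (f : OpenMatrix R (A ⊕ I) (A ⊕ J)) :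
    trace A (comp (tensor (ofMatrix (1 : Matrix A A R)) g) f) = comp g (trace A f) := by
  obtain ⟨k, M, rfl⟩ := exists_mk f
  obtain ⟨l, N, rfl⟩ := exists_mk g
  rw [ofMatrix, tensor_mk, comp_mk, trace_mk, trace_mk, comp_mk]
  refine mk_eq (X := (Fin l ⊕ (Fin k ⊕ A)) ⊕ J) (J := A)
    (Y := ((((Empty ⊕ Fin l) ⊕ Fin k) ⊕ (A ⊕ J)) ⊕ A)) 
    ⟨fun | .inl (.inl (.inl x)) => .inl (.inl (.inl (.inr x)))
         | .inl (.inl (.inr (.inl x))) => .inl (.inl (.inr x))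
         | .inl (.inl (.inr (.inr x))) => .inr x
         | .inl (.inr x) => .inl (.inr (.inr x))
         | .inr x => .inl (.inr (.inl x)),
     fun | .inl (.inl (.inl (.inr x))) => .inl (.inl (.inl x))
         | .inl (.inl (.inr x)) => .inl (.inl (.inr (.inl x)))
         | .inr x => .inl (.inl (.inr (.inr x)))
         | .inl (.inr (.inr x)) => .inl (.inr x)
         | .inl (.inr (.inl x)) => .inr x,
     by rintro (((_ | (_ | _)) | _) | _) <;> rfl, 
     by rintro (((((_ | _) | _) | (_ | _))) | _) <;> first | rfl | exact Empty.elim ‹_›⟩ ⟨?_, ?_⟩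
  · intro j j'
    rfl
  · rintro (((o | (o | o)) | o) | o) (((i | (i | i)) | i) | i) <;> simp [Matrix.one_apply]

theorem trace_comp_tensor [Fintype A] [DecidableEq A] [Fintype J]
    (f : OpenMatrix R (A ⊕ J) (A ⊕ O)) (h : OpenMatrix R I J) :
    trace A (comp f (tensor (ofMatrix (1 : Matrix A A R)) h)) = comp (trace A f) h := by
  obtain ⟨k, M, rfl⟩ := exists_mk f
  obtain ⟨l, N, rfl⟩ := exists_mk h
  rw [ofMatrix, tensor_mk, comp_mk, trace_mk, trace_mk, comp_mk]
  refine mk_eq (X := ((Fin k ⊕ A) ⊕ Fin l) ⊕ J) (J := A)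
    (Y := (((Fin k ⊕ (Empty ⊕ Fin l)) ⊕ (A ⊕ J)) ⊕ A)) 
    ⟨fun | .inl (.inl (.inr x)) => .inl (.inl (.inr (.inr x)))
         | .inl (.inl (.inl (.inl x))) => .inl (.inl (.inl x))
         | .inl (.inl (.inl (.inr x))) => .inr x
         | .inl (.inr x) => .inl (.inr (.inr x))
         | .inr x => .inl (.inr (.inl x)),
     fun | .inl (.inl (.inr (.inr x))) => .inl (.inl (.inr x))
         | .inl (.inl (.inl x)) => .inl (.inl (.inl (.inl x)))
         | .inr x => .inl (.inl (.inl (.inr x)))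
         | .inl (.inr (.inr x)) => .inl (.inr x)
         | .inl (.inr (.inl x)) => .inr x,
     by rintro ((((_ | _) | _) | _) | _) <;> rfl, 
     by rintro ((((_ | (_ | _)) | (_ | _))) | _) <;> first | rfl | exact Empty.elim ‹_›⟩ ⟨?_, ?_⟩
  · intro j j'
    rfl
  · rintro ((((o | o) | o) | o) | o) ((((i | i) | i) | i) | i) <;> simp [Matrix.one_apply]

theorem trace_swap [Fintype A] [DecidableEq A] :
    trace A (rewire id Sum.swap (ofMatrix (1 : Matrix (A ⊕ A) (A ⊕ A) R))) =
      ofMatrix (1 : Matrix A A R) := by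
  rw [ofMatrix, ofMatrix, rewire_mk, trace_mk]
  refine mk_eq (Equiv.refl _) ⟨?_, ?_⟩
  · intro j j'
    change (1 : Matrix (A ⊕ A) (A ⊕ A) R) (.inr j) (.inl j') = 0
    simp
  · rintro (o | o) (i | i)
    · exact o.elim
    · exact o.elim
    · exact i.elim
    · change (1 : Matrix A A R) o i = (1 : Matrix (A ⊕ A) (A ⊕ A) R) (.inl o) (.inr i) +
        ∑ j, (1 : Matrix (A ⊕ A) (A ⊕ A) R) (.inl o) (.inl j) *
          (1 : Matrix (A ⊕ A) (A ⊕ A) R) (.inr j) (.inr i)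
      simp [Matrix.one_apply]

theorem trace_tensor [Fintype A] (f : OpenMatrix R (A ⊕ I) (A ⊕ O)) (g : OpenMatrix R I' O') :
    trace A (rewire (Equiv.sumAssoc _ _ _).symm (Equiv.sumAssoc _ _ _).symm (tensor f g)) =
      tensor (trace A f) g := by
  obtain ⟨k, M, rfl⟩ := exists_mk f
  obtain ⟨l, N, rfl⟩ := exists_mk g
  rw [tensor_mk, rewire_mk, trace_mk, trace_mk, tensor_mk]
  refine mk_equiv ((Equiv.sumAssoc _ _ _).trans (((Equiv.refl _).sumCongr
      (Equiv.sumComm _ _)).trans (Equiv.sumAssoc _ _ _).symm)) ?_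
  rintro (((o | o) | o) | (o | o)) (((i | i) | i) | (i | i)) <;> rfl

theorem trace_comp_tensor_one {P Q M N : Type} [Fintype P] [DecidableEq P] [Fintype Q]
    [DecidableEq Q] [Fintype M] [Fintype N] (f : OpenMatrix R (M ⊕ P) (N ⊕ Q))
    (g : OpenMatrix R N M) :
    trace N (comp f (tensor g (ofMatrix (1 : Matrix P P R)))) =
      trace M (comp (tensor g (ofMatrix (1 : Matrix Q Q R))) f) := by
  obtain ⟨k, F, rfl⟩ := exists_mk f
  obtain ⟨l, G, rfl⟩ := exists_mk g
  have h₁ : trace N (comp (mk _ F) (tensor (mk _ G) (ofMatrix (1 : Matrix P P R)))) =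
      mk ((Fin k ⊕ Fin l) ⊕ (N ⊕ M)) ((Matrix.fromBlocks F 0 0 G).submatrix
        (fun | .inl (.inl (.inl x)) => .inl (.inl x)
             | .inl (.inl (.inr x)) => .inr (.inl x)
             | .inl (.inr (.inl x)) => .inl (.inr (.inl x))
             | .inl (.inr (.inr x)) => .inr (.inr x)
             | .inr x => .inl (.inr (.inr x)))
        (fun | .inl (.inl (.inl x)) => .inl (.inl x)
             | .inl (.inl (.inr x)) => .inr (.inl x)
             | .inl (.inr (.inl x)) => .inr (.inr x)
             | .inl (.inr (.inr x)) => .inl (.inr (.inl x))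
             | .inr x => .inl (.inr (.inr x)))) := by
    rw [ofMatrix, tensor_mk, comp_mk, trace_mk]
    refine mk_eq (J := P)
      ⟨fun | .inl (.inl (.inl x)) => .inl (.inl (.inl x))
           | .inl (.inl (.inr x)) => .inl (.inl (.inr (.inl x)))
           | .inl (.inr (.inl x)) => .inr x
           | .inl (.inr (.inr x)) => .inl (.inr (.inl x))
           | .inr x => .inl (.inr (.inr x)),
       fun | .inl (.inl (.inl x)) => .inl (.inl (.inl x))
           | .inl (.inl (.inr (.inl x))) => .inl (.inl (.inr x))
           | .inr x => .inl (.inr (.inl x))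
           | .inl (.inr (.inl x)) => .inl (.inr (.inr x))
           | .inl (.inr (.inr x)) => .inr x,
       by rintro (((_ | _) | (_ | _)) | _) <;> rfl, 
       by rintro (((_ | (_ | _)) | (_ | _)) | _) <;> first | rfl | exact Empty.elim ‹_›⟩ ⟨?_, ?_⟩
    · intro j j'
      rfl
    · rintro (((o | o) | (o | o)) | o) (((i | i) | (i | i)) | i) <;> simp [Matrix.one_apply]
  have h₂ : trace M (comp (tensor (mk _ G) (ofMatrix (1 : Matrix Q Q R))) (mk _ F)) =
      mk ((Fin k ⊕ Fin l) ⊕ (N ⊕ M)) ((Matrix.fromBlocks F 0 0 G).submatrix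
        (fun | .inl (.inl (.inl x)) => .inl (.inl x)
             | .inl (.inl (.inr x)) => .inr (.inl x)
             | .inl (.inr (.inl x)) => .inl (.inr (.inl x))
             | .inl (.inr (.inr x)) => .inr (.inr x)
             | .inr x => .inl (.inr (.inr x)))
        (fun | .inl (.inl (.inl x)) => .inl (.inl x)
             | .inl (.inl (.inr x)) => .inr (.inl x)
             | .inl (.inr (.inl x)) => .inr (.inr x)
             | .inl (.inr (.inr x)) => .inl (.inr (.inl x))
             | .inr x => .inl (.inr (.inr x)))) := by
    rw [ofMatrix, tensor_mk, comp_mk, trace_mk]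
    refine mk_eq (J := Q)
      ⟨fun | .inl (.inl (.inl x)) => .inl (.inl (.inr x))
           | .inl (.inl (.inr x)) => .inl (.inl (.inl (.inl x)))
           | .inl (.inr (.inl x)) => .inl (.inr (.inl x))
           | .inl (.inr (.inr x)) => .inr x
           | .inr x => .inl (.inr (.inr x)),
       fun | .inl (.inl (.inr x)) => .inl (.inl (.inl x))
           | .inl (.inl (.inl (.inl x))) => .inl (.inl (.inr x))
           | .inl (.inr (.inl x)) => .inl (.inr (.inl x))
           | .inr x => .inl (.inr (.inr x))
           | .inl (.inr (.inr x)) => .inr x,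
       by rintro (((_ | _) | (_ | _)) | _) <;> rfl, 
       by rintro ((((_ | _) | _) | (_ | _)) | _) <;> first | rfl | exact Empty.elim ‹_›⟩ ⟨?_, ?_⟩
    · intro j j'
      rfl
    · rintro (((o | o) | (o | o)) | o) (((i | i) | (i | i)) | i) <;> simp [Matrix.one_apply]
  rw [h₁, h₂]

end OpenMatrix

namespace OpenMatrix

variable {R : Type u} [Semiring R] {I O I' O' X Y J A B : Type}

theorem tensor_rewire_left {I₁ O₁ : Type} (p : I₁ → I) (q : O₁ → O) (f : OpenMatrix R I O)
    (g : OpenMatrix R I' O') :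
    tensor (rewire p q f) g = rewire (Sum.map p id) (Sum.map q id) (tensor f g) := by
  simpa only [rewire_id] using tensor_rewire p q id id f g

theorem tensor_rewire_right {I₁ O₁ : Type} (p : I₁ → I') (q : O₁ → O') (f : OpenMatrix R I O)
    (g : OpenMatrix R I' O') :
    tensor f (rewire p q g) = rewire (Sum.map id p) (Sum.map id q) (tensor f g) := by
  simpa only [rewire_id] using tensor_rewire id id p q f g

theorem comp_rewire_rewire [Fintype J] [Fintype A] (e : A ≃ J) (q : O' → O) (p : I' → I)
    (f : OpenMatrix R J O) (g : OpenMatrix R I J) :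
    comp (rewire e q f) (rewire p e g) = rewire p q (comp f g) := by
  have h₁ : rewire e q f = rewire id q (rewire e id f) := by rw [rewire_rewire]; rfl
  have h₂ : rewire p e g = rewire p id (rewire id e g) := by rw [rewire_rewire]; rfl
  rw [h₁, h₂, comp_rewire, comp_rewire_middle]

theorem rewire_comp [Fintype J] (q : O' → O) (f : OpenMatrix R J O) (g : OpenMatrix R I J) :
    comp (rewire id q f) g = rewire id q (comp f g) := by
  simpa only [rewire_id] using comp_rewire q id f g

theorem comp_rewire_id [Fintype J] (p : I' → I) (f : OpenMatrix R J O) (g : OpenMatrix R I J) :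
    comp f (rewire p id g) = rewire p id (comp f g) := by
  simpa only [rewire_id] using comp_rewire id p f g

theorem homCast_eq_rewire {a a' b b' : ℕ} (ha : a = a') (hb : b = b')
    (f : OpenMatrix R (Fin a) (Fin b)) :
    homCast (H := fun a b => OpenMatrix R (Fin a) (Fin b)) ha hb f =
      rewire (Fin.cast ha.symm) (Fin.cast hb.symm) f := by
  subst ha hb
  exact (rewire_id f).symm

theorem homCast_ofMatrix {a a' b b' : ℕ} (ha : a = a') (hb : b = b')
    (M : Matrix (Fin b) (Fin a) R) :
    homCast (H := fun a b => OpenMatrix R (Fin a) (Fin b)) ha hb (ofMatrix M) =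
      ofMatrix (homCast (H := (matPROP R).Hom) ha hb M) := by
  subst ha hb
  rfl

/-- The direct sum of open matrices with numbered inputs and outputs. -/
noncomputable def finTensor {a b c d : ℕ} (f : OpenMatrix R (Fin a) (Fin b))
    (g : OpenMatrix R (Fin c) (Fin d)) : OpenMatrix R (Fin (a + c)) (Fin (b + d)) :=
  rewire finSumFinEquiv.symm finSumFinEquiv.symm (tensor f g)

theorem finTensor_ofMatrix {a b c d : ℕ} (M : Matrix (Fin b) (Fin a) R)
    (N : Matrix (Fin d) (Fin c) R) :
    finTensor (ofMatrix M) (ofMatrix N) = ofMatrix (directSum M N) := by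
  rw [finTensor, tensor_ofMatrix, rewire_ofMatrix]
  rfl

theorem swapMatrix_eq_submatrix_left (a b : ℕ) :
    swapMatrix R a b = (1 : Matrix (Fin (a + b)) (Fin (a + b)) R).submatrix finAddFlip id := by
  ext i j
  refine Fin.addCases (fun i => ?_) (fun i => ?_) i <;>
  refine Fin.addCases (fun j => ?_) (fun j => ?_) j <;>
  simp [swapMatrix, Matrix.one_apply] <;>
  (intro h; have := congrArg Fin.val h; simp at this; omega)

theorem swapMatrix_eq_submatrix_right (a b : ℕ) :
    swapMatrix R a b = (1 : Matrix (Fin (b + a)) (Fin (b + a)) R).submatrix id finAddFlip := by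
  ext i j
  refine Fin.addCases (fun i => ?_) (fun i => ?_) i <;>
  refine Fin.addCases (fun j => ?_) (fun j => ?_) j <;>
  simp [swapMatrix, Matrix.one_apply] <;>
  (intro h; have := congrArg Fin.val h; simp at this; omega)

theorem swapMatrix_comp {a b : ℕ} (f : OpenMatrix R I (Fin (a + b))) :
    comp (ofMatrix (swapMatrix R a b)) f = rewire id finAddFlip f := by
  rw [swapMatrix_eq_submatrix_left, ← rewire_ofMatrix, rewire_comp, ofMatrix_one_comp]

theorem comp_swapMatrix {a b : ℕ} (f : OpenMatrix R (Fin (b + a)) O) :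
    comp f (ofMatrix (swapMatrix R a b)) = rewire finAddFlip id f := by
  rw [swapMatrix_eq_submatrix_right, ← rewire_ofMatrix, comp_rewire_id, comp_ofMatrix_one]

theorem swap_finSumFinEquiv_symm (a b : ℕ) :
    Sum.swap ∘ finSumFinEquiv.symm = finSumFinEquiv.symm ∘ (finAddFlip : Fin (a + b) ≃ _) := by
  ext i
  refine Fin.addCases (fun i => ?_) (fun i => ?_) i <;> simp

variable (R) in
/-- The prop of open matrices. -/
noncomputable def toPROP : PROP.{u} where
  Hom a b := OpenMatrix R (Fin a) (Fin b)
  id a := ofMatrix 1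
  comp f g := comp f g
  tensor f g := finTensor f g
  braid a b := ofMatrix (swapMatrix R a b)
  comp_assoc f g h := comp_assoc f g h
  id_comp f := ofMatrix_one_comp f
  comp_id f := comp_ofMatrix_one f
  tensor_assoc {a b c d e g} f h k := by
    have key : ∀ a b c : ℕ, (Equiv.sumAssoc _ _ _ ∘ Sum.map finSumFinEquiv.symm id ∘
        finSumFinEquiv.symm ∘ Fin.cast (Nat.add_assoc a b c).symm :
          Fin (a + (b + c)) → Fin a ⊕ (Fin b ⊕ Fin c)) =
        Sum.map id finSumFinEquiv.symm ∘ finSumFinEquiv.symm := by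
      intro a b c
      ext i
      refine Fin.addCases (fun i => ?_) (fun i => Fin.addCases (fun i => ?_) (fun i => ?_) i) i <;>
      simp [cast_castAdd_add, cast_natAdd_castAdd, cast_natAdd_natAdd]
    rw [homCast_eq_rewire]
    simp only [finTensor, tensor_rewire_left, tensor_rewire_right, tensor_assoc, rewire_rewire]
    exact congrArg₂ (fun p q => rewire p q _) (key _ _ _) (key _ _ _)
  tensor_comp f g h k := by
    rw [finTensor, finTensor, finTensor, comp_rewire_rewire, tensor_comp]
  tensor_id a b := (finTensor_ofMatrix _ _).trans (congrArg ofMatrix ((matPROP R).tensor_id a b))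
  tensor_empty f := by
    rw [homCast_eq_rewire, finTensor, rewire_rewire]
    refine Eq.trans (congrArg₂ (fun p q => rewire p q _) ?_ ?_) (tensor_empty f 1) <;>
    exact funext fun i => finSumFinEquiv_symm_apply_castAdd i
  empty_tensor f := by
    rw [homCast_eq_rewire, finTensor, rewire_rewire, tensor_swap, rewire_rewire]
    refine Eq.trans (congrArg₂ (fun p q => rewire p q _) ?_ ?_) (tensor_empty f 1) <;>
    · ext i
      have h : Fin.cast (Nat.zero_add _).symm i = Fin.natAdd 0 i := by
        ext
        simp
      exact (congrArg (fun x => Sum.swap (finSumFinEquiv.symm x)) h).trans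
        (congrArg Sum.swap (finSumFinEquiv_symm_apply_natAdd i))
  braid_braid a b := (comp_ofMatrix _ _).trans (congrArg ofMatrix ((matPROP R).braid_braid a b))
  braid_natural f g := by
    rw [swapMatrix_comp, comp_swapMatrix, finTensor, finTensor, tensor_swap, rewire_rewire,
      rewire_rewire, rewire_rewire, ← swap_finSumFinEquiv_symm]
    refine congrArg₂ (fun p q => rewire p q _) ?_ ?_
    · exact swap_finSumFinEquiv_symm _ _
    · ext i
      simp
  braid_add a b c := by
    rw [finTensor_ofMatrix, finTensor_ofMatrix, homCast_ofMatrix]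
    exact (congrArg ofMatrix ((matPROP R).braid_add a b c)).trans
      ((homCast_ofMatrix _ _ _).symm.trans (congrArg (homCast _ _) (comp_ofMatrix _ _).symm))

/-- The trace that closes the first wire. -/
noncomputable def finTrace {m n : ℕ} (f : OpenMatrix R (Fin (1 + m)) (Fin (1 + n))) :
    OpenMatrix R (Fin m) (Fin n) :=
  trace (Fin 1) (rewire finSumFinEquiv finSumFinEquiv f)

theorem trIter_finTrace (k : ℕ) {m n : ℕ} (f : OpenMatrix R (Fin (k + m)) (Fin (k + n))) :
    trIter (H := fun a b => OpenMatrix R (Fin a) (Fin b)) finTrace k f =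
      trace (Fin k) (rewire finSumFinEquiv finSumFinEquiv f) := by
  induction k with
  | zero =>
    have key : ∀ m : ℕ, Fin.cast (Nat.zero_add m).symm =
        (finSumFinEquiv : Fin 0 ⊕ Fin m ≃ _) ∘ Sum.inr := by
      intro m
      ext i
      simp
    rw [trIter, homCast_eq_rewire, trace_empty, rewire_rewire, key, key]
  | succ k ih =>
    have key : ∀ m : ℕ, (Fin.cast ((congrArg (· + m) (Nat.add_comm k 1)).trans
          (Nat.add_assoc 1 k m)).symm ∘ finSumFinEquiv ∘ Sum.map id finSumFinEquiv ∘
            Equiv.sumAssoc (Fin 1) (Fin k) (Fin m)) =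
        finSumFinEquiv ∘ Sum.map (finSumFinEquiv.trans (finCongr (Nat.add_comm 1 k))) id := by
      intro m
      ext ((i | i) | i)
      · simp
      · simp [Nat.add_comm]
      · simp
        omega
    rw [trIter, ih, finTrace, homCast_eq_rewire, ← trace_rewire, trace_trace, rewire_rewire,
      rewire_rewire, rewire_rewire,
      ← trace_rewire_equiv (finSumFinEquiv.trans (finCongr (Nat.add_comm 1 k))), rewire_rewire,
      ← key, ← key]

end OpenMatrix

namespace OpenMatrix

variable {R : Type u} [Semiring R] {I O I' O' X Y J A B : Type}

theorem rewire_comp_finSum {a b c d e g : ℕ} (f : OpenMatrix R (Fin (c + d)) (Fin (e + g)))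
    (h : OpenMatrix R (Fin (a + b)) (Fin (c + d))) :
    rewire finSumFinEquiv finSumFinEquiv (comp f h) =
      comp (rewire finSumFinEquiv finSumFinEquiv f) (rewire finSumFinEquiv finSumFinEquiv h) :=
  (comp_rewire_rewire _ _ _ _ _).symm

theorem rewire_finTensor {a b c d : ℕ} (f : OpenMatrix R (Fin a) (Fin b))
    (g : OpenMatrix R (Fin c) (Fin d)) :
    rewire finSumFinEquiv finSumFinEquiv (finTensor f g) = tensor f g := by
  rw [finTensor, rewire_rewire, Equiv.symm_comp_self, Equiv.symm_comp_self, rewire_id]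

theorem finTrace_tightening {a b c d : ℕ} (g : OpenMatrix R (Fin c) (Fin d))
    (f : OpenMatrix R (Fin (1 + b)) (Fin (1 + c))) (h : OpenMatrix R (Fin a) (Fin b)) :
    finTrace (comp (comp (finTensor (ofMatrix 1) g) f) (finTensor (ofMatrix 1) h)) =
      comp (comp g (finTrace f)) h := by
  rw [finTrace, rewire_comp_finSum, rewire_comp_finSum, rewire_finTensor, rewire_finTensor,
    trace_comp_tensor, trace_tensor_comp, finTrace]

theorem finTrace_swapMatrix : finTrace (ofMatrix (swapMatrix R 1 1)) = ofMatrix 1 := by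
  rw [← trace_swap, finTrace, rewire_ofMatrix, rewire_ofMatrix]
  refine congrArg (fun M => trace (Fin 1) (ofMatrix M)) ?_
  ext (i | i) (j | j) <;> simp [swapMatrix, Matrix.one_apply]

theorem trace_sliding {m n p q : ℕ} (f : OpenMatrix R (Fin (m + p)) (Fin (n + q)))
    (g : OpenMatrix R (Fin n) (Fin m)) :
    trace (Fin n) (rewire finSumFinEquiv finSumFinEquiv (comp f (finTensor g (ofMatrix 1)))) =
      trace (Fin m)
        (rewire finSumFinEquiv finSumFinEquiv (comp (finTensor g (ofMatrix 1)) f)) := by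
  rw [rewire_comp_finSum, rewire_comp_finSum, rewire_finTensor, rewire_finTensor,
    trace_comp_tensor_one]

theorem finTrace_finTensor {a b c d : ℕ} (f : OpenMatrix R (Fin (1 + a)) (Fin (1 + b)))
    (g : OpenMatrix R (Fin c) (Fin d)) :
    finTrace (homCast (H := fun a b => OpenMatrix R (Fin a) (Fin b)) (Nat.add_assoc 1 a c)
      (Nat.add_assoc 1 b d) (finTensor f g)) = finTensor (finTrace f) g := by
  have key : ∀ a c : ℕ, (finSumFinEquiv.symm ∘ Fin.cast (Nat.add_assoc 1 a c).symm ∘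
      finSumFinEquiv : Fin 1 ⊕ Fin (a + c) → Fin (1 + a) ⊕ Fin c) =
      Sum.map finSumFinEquiv id ∘ (Equiv.sumAssoc _ _ _).symm ∘
        Sum.map id finSumFinEquiv.symm := by
    intro a c
    funext x
    obtain ⟨x, rfl⟩ := ((Equiv.refl _).sumCongr finSumFinEquiv).surjective x
    rcases x with (i | i | i)
    · simp [cast_castAdd_add]
    · simp [cast_natAdd_castAdd]
    · simp [cast_natAdd_natAdd]
  rw [homCast_eq_rewire, finTensor, finTensor, finTrace, finTrace, ← trace_tensor,
    ← trace_rewire, tensor_rewire_left]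
  simp only [rewire_rewire]
  exact congrArg₂ (fun p q => trace (Fin 1) (rewire p q (tensor f g))) (key _ _) (key _ _)

variable (R) in
/-- The traced prop of open matrices. -/
noncomputable def toTracedPROP : TracedPROP.{u} where
  toPROP := toPROP R
  tr f := finTrace f
  tightening g f h := finTrace_tightening g f h
  yanking := finTrace_swapMatrix
  sliding f g := (trIter_finTrace _ _).trans ((trace_sliding f g).trans (trIter_finTrace _ _).symm)
  strength f g := finTrace_finTensor f g

variable (R) in
/-- The prop functor from matrices to open matrices. -/
noncomputable def ofMatrixFunctor : PROPFunctor (matPROP R) (toTracedPROP R).toPROP where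
  map M := ofMatrix M
  map_id _ := rfl
  map_comp M N := (comp_ofMatrix M N).symm
  map_tensor M N := (finTensor_ofMatrix M N).symm
  map_braid _ _ := rfl

end OpenMatrix

/-! ### Parry-Sullivan classes -/

section PSClass

variable {R : Type u} [Semiring R] {X Y : Type} [Fintype X] [Fintype Y]

/-- The PS-equivalence class of a matrix with an arbitrary finite index type. -/
noncomputable def psClass (M : Matrix X X R) : Quot (PSStep R) :=
  Quot.mk _ ⟨Fintype.card X, M.submatrix (Fintype.equivFin X).symm (Fintype.equivFin X).symm⟩

theorem psClass_mul_comm (A : Matrix X Y R) (B : Matrix Y X R) :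
    psClass (A * B) = psClass (B * A) := by
  have h := Quot.sound (PSStep.swap
    (A.submatrix (Fintype.equivFin X).symm (Fintype.equivFin Y).symm)
    (B.submatrix (Fintype.equivFin Y).symm (Fintype.equivFin X).symm))
  rwa [Matrix.submatrix_mul_equiv, Matrix.submatrix_mul_equiv] at h

theorem psClass_submatrix_equiv (e : X ≃ Y) (M : Matrix Y Y R) :
    psClass (M.submatrix e e) = psClass M := by
  classical
  have h := psClass_mul_comm (M.submatrix e (Equiv.refl Y))
    ((1 : Matrix Y Y R).submatrix (Equiv.refl Y) e)
  rw [Matrix.submatrix_mul_equiv, Matrix.submatrix_mul_equiv] at h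
  simpa using h

theorem psClass_fin {n : ℕ} (M : Matrix (Fin n) (Fin n) R) : psClass M = Quot.mk _ ⟨n, M⟩ := by
  have h := Quot.sound (PSStep.swap
    (M.submatrix (Fintype.equivFin (Fin n)).symm (Equiv.refl (Fin n)))
    ((1 : Matrix (Fin n) (Fin n) R).submatrix (Equiv.refl (Fin n))
      (Fintype.equivFin (Fin n)).symm))
  rw [Matrix.submatrix_mul_equiv, Matrix.submatrix_mul_equiv] at h
  simpa [psClass] using h

/-- The expansion of the row `none` of a matrix. -/
def expandNone (W : Matrix (Option X) (Option X) R) :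
    Matrix (Option (Option X)) (Option (Option X)) R :=
  Matrix.of fun
    | some (some x), some c => W (some x) c
    | some (some _), none => 0
    | some none, some _ => 0
    | some none, none => 1
    | none, some c => W none c
    | none, none => 0

theorem psClass_expandNone (W : Matrix (Option X) (Option X) R) :
    psClass (expandNone W) = psClass W := by
  let f : Fin (Fintype.card X + 1) ≃ Option X :=
    (finSuccEquiv _).trans (Equiv.optionCongr (Fintype.equivFin X).symm)
  let g : Fin (Fintype.card X + 2) ≃ Option (Option X) :=
    finSuccEquivLast.trans (Equiv.optionCongr f)
  have h := Quot.sound (PSStep.expand (W.submatrix f f))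
  have h' : expandMatrix (W.submatrix f f) = (expandNone W).submatrix g g := by
    have f0 : f 0 = none := by simp [f]
    have fs : ∀ i : Fin (Fintype.card X), f i.succ = some ((Fintype.equivFin X).symm i) :=
      fun i => congrArg (Equiv.optionCongr _) (finSuccEquiv_succ i)
    have gc : ∀ i : Fin (Fintype.card X + 1), g i.castSucc = some (f i) :=
      fun i => congrArg (Equiv.optionCongr _) (finSuccEquivLast_castSucc i)
    have g0 : g 0 = some none := (gc 0).trans (congrArg some f0)
    have gs : ∀ i : Fin (Fintype.card X), g i.castSucc.succ =
        some (some ((Fintype.equivFin X).symm i)) :=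
      fun i => (gc i.succ).trans (congrArg some (fs i))
    have gl : g (Fin.last _) = none := congrArg (Equiv.optionCongr _) finSuccEquivLast_last
    ext i j
    refine Fin.cases ?_ (fun i => Fin.lastCases ?_ (fun i => ?_) i) i <;>
    refine Fin.lastCases ?_ (fun j => ?_) j <;>
    simp [expandMatrix, g0, gs, gc, gl, fs, f0, expandNone]
  rw [h', ← psClass_fin, ← psClass_fin, psClass_submatrix_equiv, psClass_submatrix_equiv] at h
  exact h.symm

theorem psClass_eliminate_none (N : Matrix (Option X) (Option X) R) (h : N none none = 0) :
    psClass N = psClass (Matrix.of fun x y : X =>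
      N (some x) (some y) + N (some x) none * N none (some y)) := by
  classical
  let A : Matrix X (Option X) R := Matrix.of fun
    | x, some y => if x = y then 1 else 0
    | x, none => N (some x) none
  let B : Matrix (Option X) X R := Matrix.of fun x y => N x (some y)
  let A' : Matrix (Option X) (Option (Option X)) R := Matrix.of fun
    | some x, some c => A x c
    | some _, none => 0
    | none, some _ => 0
    | none, none => 1
  let B' : Matrix (Option (Option X)) (Option X) R := Matrix.of fun
    | some (some x), some y => B (some x) y
    | some (some _), none => 0
    | some none, some _ => 0
    | some none, none => 1
    | none, some y => B none y
    | none, none => 0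
  have h₁ : A * B = Matrix.of fun x y : X =>
      N (some x) (some y) + N (some x) none * N none (some y) := by
    ext x y
    simp [Matrix.mul_apply, A, B, add_comm]
  have h₂ : A' * B' = N := by
    ext (_ | x) (_ | y) <;> simp [Matrix.mul_apply, A', B', A, B, h]
  have h₃ : B' * A' = expandNone (B * A) := by
    ext (_ | _ | x) (_ | y) <;> simp [Matrix.mul_apply, A', B', expandNone]
  rw [← h₁, ← h₂, psClass_mul_comm, h₃, psClass_expandNone, psClass_mul_comm]

theorem psClass_eliminate {j : ℕ} (N : Matrix (X ⊕ Fin j) (X ⊕ Fin j) R)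
    (h : ∀ i i', N (.inr i) (.inr i') = 0) :
    psClass N = psClass (Matrix.of fun x y : X =>
      N (.inl x) (.inl y) + ∑ i, N (.inl x) (.inr i) * N (.inr i) (.inl y)) := by
  induction j with
  | zero =>
    rw [← psClass_submatrix_equiv (Equiv.sumEmpty X (Fin 0)).symm N]
    refine congrArg psClass ?_
    ext x y
    simp
  | succ j ih =>
    let e : Option (X ⊕ Fin j) ≃ X ⊕ Fin (j + 1) :=
      ⟨fun | none => .inr 0 | some (.inl x) => .inl x | some (.inr i) => .inr i.succ,
       fun | .inl x => some (.inl x)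
           | .inr i => Fin.cases none (fun i => some (.inr i)) i,
       by rintro (_ | _ | _) <;> rfl,
       by
        rintro (_ | i)
        · rfl
        · refine Fin.cases ?_ (fun i => ?_) i <;> rfl⟩
    rw [← psClass_submatrix_equiv e, psClass_eliminate_none _ (h 0 0), ih]
    · refine congrArg psClass ?_
      ext x y
      simp [e, h, Fin.sum_univ_succ, add_assoc]
    · intro i i'
      simp [e, h]

theorem psClass_eq_of_eliminatesTo {I O J : Type} [Fintype J] (e : X ⊕ J ≃ Y)
    {N : Matrix (Y ⊕ O) (Y ⊕ I) R} {M : Matrix (X ⊕ O) (X ⊕ I) R} (h : EliminatesTo e N M) :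
    psClass (N.submatrix Sum.inl Sum.inl) = psClass (M.submatrix Sum.inl Sum.inl) := by
  rw [← psClass_submatrix_equiv (((Equiv.refl X).sumCongr (Fintype.equivFin J).symm).trans e),
    psClass_eliminate]
  · refine congrArg psClass ?_
    ext x y
    exact (congrArg _ ((Fintype.equivFin J).symm.sum_comp
      fun j => N (.inl (e (.inl x))) (.inl (e (.inr j))) *
        N (.inl (e (.inr j))) (.inl (e (.inl y))))).trans (h.2 (.inl x) (.inl y)).symm
  · intro i i'
    exact h.1 _ _

end PSClass

/-- The PS-equivalence class of a closed open matrix. -/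
noncomputable def OpenMatrix.toPSClass {R : Type u} [Semiring R] {I O : Type} :
    OpenMatrix R I O → Quot (PSStep R) :=
  lift (fun _ M => psClass (M.submatrix Sum.inl Sum.inl)) fun e _ _ h =>
    psClass_eq_of_eliminatesTo e h

theorem OpenMatrix.toPSClass_mk {R : Type u} [Semiring R] {I O X : Type} [Fintype X]
    (M : Matrix (X ⊕ O) (X ⊕ I) R) :
    toPSClass (mk X M) = psClass (M.submatrix Sum.inl Sum.inl) :=
  psClass_submatrix_equiv (Fintype.equivFin X).symm (M.submatrix Sum.inl Sum.inl)

theorem OpenMatrix.toPSClass_fullTrace {R : Type u} [Semiring R] {n : ℕ}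
    (M : Matrix (Fin n) (Fin n) R) :
    toPSClass ((toTracedPROP R).fullTrace ((ofMatrixFunctor R).map M)) = Quot.mk _ ⟨n, M⟩ := by
  have h : (toTracedPROP R).fullTrace ((ofMatrixFunctor R).map M) = trace (Fin n) (I := Fin 0)
      (O := Fin 0) (rewire finSumFinEquiv finSumFinEquiv (ofMatrix M)) :=
    trIter_finTrace (m := 0) (n := 0) n (ofMatrix M)
  rw [h, ofMatrix, rewire_mk, trace_mk, toPSClass_mk, ← psClass_fin,
    ← psClass_submatrix_equiv (Equiv.emptySum Empty (Fin n)) M]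
  refine congrArg psClass ?_
  ext (i | i) (j | j)
  · exact i.elim
  · exact i.elim
  · exact j.elim
  · rfl

/-! ### Full traces of matrices in a traced prop -/

namespace TracedPROP

theorem fullTrace_comp_comm (T : TracedPROP.{u}) {m n : ℕ} (f : T.Hom m n) (g : T.Hom n m) :
    T.fullTrace (T.comp f g) = T.fullTrace (T.comp g f) := by
  have h : T.tensor g (T.id 0) = g := T.tensor_empty g
  have h' := T.sliding (p := 0) (q := 0) f g
  rw [h] at h'
  exact h'

theorem fullTrace_one_add (T : TracedPROP.{u}) {k : ℕ} (f : T.Hom (1 + k) (1 + k)) :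
    T.fullTrace f = T.fullTrace (T.tr f) := by
  have h : ∀ {n : ℕ} (hn : 1 + k = n) , T.fullTrace f = T.fullTrace (homCast hn hn f) := by
    intro n hn
    subst hn
    rfl
  have h' : ∀ {n : ℕ} (h₁ : 1 + k = n) (h₂ : n = 1 + k), homCast h₂ h₂ (homCast h₁ h₁ f) = f := by
    intro n h₁ h₂
    subst h₁
    rfl
  rw [h (Nat.add_comm 1 k)]
  exact congrArg (fun f => T.fullTrace (T.tr f)) (h' (Nat.add_comm 1 k) _)

variable {R : Type u} [Semiring R] {T : TracedPROP.{v}} (ι : PROPFunctor (matPROP R) T.toPROP)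

theorem fullTrace_map_mul_comm {m n : ℕ} (A : Matrix (Fin n) (Fin m) R)
    (B : Matrix (Fin m) (Fin n) R) :
    T.fullTrace (ι.map (a := n) (b := n) (A * B)) =
      T.fullTrace (ι.map (a := m) (b := m) (B * A)) := by
  have h₁ : ι.map (a := n) (b := n) (A * B) = T.comp (ι.map A) (ι.map B) := ι.map_comp A B
  have h₂ : ι.map (a := m) (b := m) (B * A) = T.comp (ι.map B) (ι.map A) := ι.map_comp B A
  rw [h₁, h₂, fullTrace_comp_comm]

theorem fullTrace_map_submatrix {m n : ℕ} (e : Fin m ≃ Fin n) (M : Matrix (Fin n) (Fin n) R) :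
    T.fullTrace (ι.map (a := m) (b := m) (M.submatrix e e)) =
      T.fullTrace (ι.map (a := n) (b := n) M) := by
  have h := fullTrace_map_mul_comm ι (M.submatrix e (Equiv.refl _))
    ((1 : Matrix (Fin n) (Fin n) R).submatrix (Equiv.refl _) e)
  rw [Matrix.submatrix_mul_equiv, Matrix.submatrix_mul_equiv] at h
  simpa using h

theorem tr_map_swap_comp_tensor {n : ℕ} (M : (matPROP R).Hom (1 + n) (1 + n)) :
    T.tr (ι.map ((matPROP R).comp
      (homCast (Nat.add_assoc 1 1 n) (Nat.add_assoc 1 1 n)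
        ((matPROP R).tensor ((matPROP R).braid 1 1) ((matPROP R).id n)))
      ((matPROP R).tensor ((matPROP R).id 1) M))) = ι.map M := by
  have h₁ : T.tr (ι.map (homCast (Nat.add_assoc 1 1 n) (Nat.add_assoc 1 1 n)
      ((matPROP R).tensor ((matPROP R).braid 1 1) ((matPROP R).id n)))) = T.id (1 + n) := by
    rw [map_homCast (K := T.Hom) (fun _ _ => ι.map), ι.map_tensor, ι.map_braid, ι.map_id,
      T.strength, T.yanking, T.tensor_id]
  have h₂ := T.tightening (T.id _) (ι.map (homCast (Nat.add_assoc 1 1 n) (Nat.add_assoc 1 1 n)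
      ((matPROP R).tensor ((matPROP R).braid 1 1) ((matPROP R).id n)))) (ι.map M)
  rw [h₁, T.tensor_id, T.id_comp, T.id_comp, T.id_comp] at h₂
  rw [ι.map_comp, ι.map_tensor, ι.map_id, h₂]

theorem submatrix_cast_directSum_swapMatrix_mul {p q n m : ℕ} (h : q + (p + n) = q + p + n)
    (h' : p + (q + n) = p + q + n) (A : Matrix (Fin (p + (q + n))) (Fin m) R) :
    (directSum (swapMatrix R p q) (1 : Matrix (Fin n) (Fin n) R)).submatrix (Fin.cast h)
      (Fin.cast h') * A =
    A.submatrix (Fin.addCases (fun i => Fin.natAdd p (Fin.castAdd n i))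
        (Fin.addCases (fun i => Fin.castAdd _ i) (fun i => Fin.natAdd p (Fin.natAdd q i)))) id := by
  ext i j
  rw [Matrix.mul_apply, Fin.sum_univ_add, Fin.sum_univ_add]
  refine Fin.addCases (fun i => ?_) (fun i => Fin.addCases (fun i => ?_) (fun i => ?_) i) i <;>
  simp [cast_castAdd_add, cast_natAdd_castAdd, cast_natAdd_natAdd, directSum, swapMatrix,
    Matrix.one_apply]

theorem fullTrace_map_expandMatrix {n : ℕ} (M : Matrix (Fin (n + 1)) (Fin (n + 1)) R) :
    T.fullTrace (ι.map (a := n + 2) (b := n + 2) (expandMatrix M)) =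
      T.fullTrace (ι.map (a := n + 1) (b := n + 1) M) := by
  let c : Fin (1 + n) ≃ Fin (n + 1) := finCongr (Nat.add_comm 1 n)
  let e : Fin (1 + (1 + n)) ≃ Fin (n + 2) :=
    finAddFlip.trans (finCongr (congrArg (· + 1) (Nat.add_comm 1 n)))
  refine Eq.trans ?_ ((congrArg T.fullTrace (tr_map_swap_comp_tensor ι (M.submatrix c c))).trans
    (fullTrace_map_submatrix ι c M))
  rw [← fullTrace_one_add]
  refine (fullTrace_map_submatrix ι e _).symm.trans ?_
  refine congrArg (fun M => T.fullTrace (ι.map (a := 1 + (1 + n)) (b := 1 + (1 + n)) M)) ?_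
  refine Eq.trans ?_ ((congrArg (fun S : Matrix _ _ R => S * directSum 1 (M.submatrix c c))
    (homCast_matrix _ _ (directSum (swapMatrix R 1 1) 1))).trans
      (submatrix_cast_directSum_swapMatrix_mul (Nat.add_assoc 1 1 n).symm _ _)).symm
  have e0 : ∀ i : Fin 1, e (Fin.castAdd (1 + n) i) = Fin.last (n + 1) := by
    intro i
    ext
    simp [e]
  have e1 : ∀ i : Fin 1, e (Fin.natAdd 1 (Fin.castAdd n i)) = 0 := by
    intro i
    ext
    simp [e]
  have e2 : ∀ i : Fin n, e (Fin.natAdd 1 (Fin.natAdd 1 i)) = i.castSucc.succ := by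
    intro i
    ext
    simp [e]
    omega
  have c0 : ∀ i : Fin 1, c (Fin.castAdd n i) = 0 := by
    intro i
    ext
    simp [c]
  have c1 : ∀ i : Fin n, c (Fin.natAdd 1 i) = i.succ := by
    intro i
    ext
    simp [c]
  have es : ∀ j : Fin (1 + n), e (Fin.natAdd 1 j) = (c j).castSucc := by
    intro j
    ext
    simp [e, c]
  refine Matrix.ext fun i j => ?_
  rw [Matrix.submatrix_apply, Matrix.submatrix_apply]
  refine Fin.addCases (fun i => ?_) (fun i => Fin.addCases (fun i => ?_) (fun i => ?_) i) i <;>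
  refine Fin.addCases (fun j => ?_) (fun j => ?_) j <;>
  simp [expandMatrix, directSum, e0, e1, e2, c0, c1, es, Matrix.one_apply]
  exact fun h => absurd (Subsingleton.elim _ _) h

theorem fullTrace_map_eq {m n : ℕ} {M : Matrix (Fin n) (Fin n) R} {N : Matrix (Fin m) (Fin m) R}
    (h : PSEquiv M N) :
    T.fullTrace (ι.map (a := n) (b := n) M) = T.fullTrace (ι.map (a := m) (b := m) N) := by
  let φ : SquareMatrix R → T.Hom 0 0 := fun M => T.fullTrace (ι.map (a := M.1) (b := M.1) M.2)
  have hφ : ∀ M N, PSStep R M N → φ M = φ N := by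
    rintro _ _ (⟨A, B⟩ | M)
    · exact fullTrace_map_mul_comm ι A B
    · exact (fullTrace_map_expandMatrix ι M).symm
  exact congrArg (Quot.lift φ hφ) (Quot.eqvGen_sound h)

end TracedPROP

theorem IsTracedCompletion.fullTrace_eq_iff {R : Type u} [Semiring R] {T : TracedPROP.{u}}
    {ι : PROPFunctor (matPROP R) T.toPROP} (hT : IsTracedCompletion T ι) {n m : ℕ}
    (M : Matrix (Fin n) (Fin n) R) (N : Matrix (Fin m) (Fin m) R) :
    T.fullTrace (ι.map (a := n) (b := n) M) = T.fullTrace (ι.map (a := m) (b := m) N) ↔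
      PSEquiv M N := by
  refine ⟨fun h => ?_, TracedPROP.fullTrace_map_eq ι⟩
  obtain ⟨G, hG, -⟩ := hT (OpenMatrix.toTracedPROP R) (OpenMatrix.ofMatrixFunctor R)
  have key : ∀ {n : ℕ} (M : Matrix (Fin n) (Fin n) R),
      OpenMatrix.toPSClass (G.map (T.fullTrace (ι.map (a := n) (b := n) M))) =
        Quot.mk _ ⟨n, M⟩ := by
    intro n M
    rw [← OpenMatrix.toPSClass_fullTrace, ← hG]
    exact congrArg OpenMatrix.toPSClass
      (map_trIter (H := T.Hom) (K := (OpenMatrix.toTracedPROP R).Hom) (fun _ _ => G.map) T.tr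
        (OpenMatrix.toTracedPROP R).tr G.map_tr n (m := 0) (n := 0) _)
  exact Quot.eqvGen_exact ((key M).symm.trans
    ((congrArg (fun f => OpenMatrix.toPSClass (G.map f)) h).trans (key N)))

/-! ### The symmetric monoidal category of a prop -/

namespace PROP

open CategoryTheory MonoidalCategory

variable (Q : PROP.{u})

/-- The identity, with the source and the target written differently. -/
def castHom {a b : ℕ} (h : a = b) : Q.Hom a b :=
  homCast rfl h (Q.id a)

theorem castHom_rfl (a : ℕ) : Q.castHom (rfl : a = a) = Q.id a :=
  rfl

theorem castHom_comp_castHom {a b c : ℕ} (h : a = b) (h' : b = c) :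
    Q.comp (Q.castHom h') (Q.castHom h) = Q.castHom (h.trans h') := by
  subst h h'
  exact Q.id_comp _

theorem tensor_castHom {a b c d : ℕ} (h : a = b) (h' : c = d) :
    Q.tensor (Q.castHom h) (Q.castHom h') = Q.castHom (congrArg₂ (· + ·) h h') := by
  subst h h'
  exact Q.tensor_id _ _

theorem homCast_eq_comp {a a' b b' : ℕ} (ha : a = a') (hb : b = b') (f : Q.Hom a b) :
    homCast ha hb f = Q.comp (Q.castHom hb) (Q.comp f (Q.castHom ha.symm)) := by
  subst ha hb
  exact ((Q.id_comp _).trans (Q.comp_id f)).symm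

theorem castHom_comp_of_homCast_eq {a a' b b' : ℕ} {ha : a = a'} {hb : b = b'} {f : Q.Hom a b}
    {g : Q.Hom a' b'} (h : homCast ha hb f = g) :
    Q.comp (Q.castHom hb) f = Q.comp g (Q.castHom ha) := by
  subst ha hb h
  exact (Q.id_comp _).trans (Q.comp_id f).symm

/-- The objects of a prop, as a category. -/
structure Obj (Q : PROP.{u}) where
  /-- the number of wires -/
  n : ℕ

instance : Category.{u} Q.Obj where
  Hom X Y := Q.Hom X.n Y.n
  id X := Q.id X.n
  comp f g := Q.comp g f
  id_comp f := Q.comp_id f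
  comp_id f := Q.id_comp f
  assoc f g h := (Q.comp_assoc h g f).symm

/-- The isomorphism of objects with the same number of wires. -/
def castIso {X Y : Q.Obj} (h : X.n = Y.n) : X ≅ Y where
  hom := Q.castHom h
  inv := Q.castHom h.symm
  hom_inv_id := Q.castHom_comp_castHom h h.symm
  inv_hom_id := Q.castHom_comp_castHom h.symm h

instance : MonoidalCategoryStruct Q.Obj where
  tensorObj X Y := ⟨X.n + Y.n⟩
  whiskerLeft X _ _ f := Q.tensor (Q.id X.n) f
  whiskerRight f Y := Q.tensor f (Q.id Y.n)
  tensorHom f g := Q.tensor f g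
  tensorUnit := ⟨0⟩
  associator X Y Z := Q.castIso (Nat.add_assoc X.n Y.n Z.n)
  leftUnitor X := Q.castIso (Nat.zero_add X.n)
  rightUnitor X := Q.castIso (Nat.add_zero X.n)

instance : MonoidalCategory Q.Obj :=
  MonoidalCategory.ofTensorHom
    (id_tensorHom_id := fun X Y => Q.tensor_id X.n Y.n)
    (tensorHom_comp_tensorHom := fun f₁ f₂ g₁ g₂ => (Q.tensor_comp g₁ f₁ g₂ f₂).symm)
    (associator_naturality := fun f g h => Q.castHom_comp_of_homCast_eq (Q.tensor_assoc f g h))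
    (leftUnitor_naturality := fun f => Q.castHom_comp_of_homCast_eq (Q.empty_tensor f))
    (rightUnitor_naturality := fun f => Q.castHom_comp_of_homCast_eq (Q.tensor_empty f))
    (pentagon := fun W X Y Z => by
      change Q.comp (Q.comp (Q.tensor (Q.castHom (rfl : W.n = W.n)) (Q.castHom _)) (Q.castHom _))
        (Q.tensor (Q.castHom _) (Q.castHom (rfl : Z.n = Z.n))) = Q.comp (Q.castHom _) (Q.castHom _)
      rw [tensor_castHom, castHom_comp_castHom, tensor_castHom, castHom_comp_castHom,
        castHom_comp_castHom])
    (triangle := fun X Y => by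
      change Q.comp (Q.tensor (Q.castHom (rfl : X.n = X.n)) (Q.castHom _)) (Q.castHom _) =
        Q.tensor (Q.castHom (Nat.add_zero X.n)) (Q.castHom (rfl : Y.n = Y.n))
      rw [tensor_castHom, castHom_comp_castHom, tensor_castHom])

/-- The symmetry as an isomorphism. -/
def braidIso (X Y : Q.Obj) : X ⊗ Y ≅ Y ⊗ X where
  hom := Q.braid X.n Y.n
  inv := Q.braid Y.n X.n
  hom_inv_id := Q.braid_braid X.n Y.n
  inv_hom_id := Q.braid_braid Y.n X.n

theorem hexagon_reverse (X Y Z : Q.Obj) :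
    (α_ X Y Z).inv ≫ (Q.braidIso (X ⊗ Y) Z).hom ≫ (α_ Z X Y).inv =
      X ◁ (Q.braidIso Y Z).hom ≫ (α_ X Z Y).inv ≫ (Q.braidIso X Z).hom ▷ Y := by
  have h := Q.braid_add X.n Y.n Z.n
  rw [homCast_eq_comp, homCast_eq_comp, castHom_rfl, Q.comp_id] at h
  have h' : (Q.braidIso (X ⊗ Y) Z).hom = (α_ X Y Z).hom ≫ X ◁ (Q.braidIso Y Z).hom ≫
      (α_ X Z Y).inv ≫ (Q.braidIso X Z).hom ▷ Y ≫ (α_ Z X Y).hom := by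
    simp only [← Q.comp_assoc] at h
    exact h
  rw [h']
  simp

instance : SymmetricCategory Q.Obj where
  braiding X Y := Q.braidIso X Y
  braiding_naturality_right X _ _ f := (Q.braid_natural (Q.id X.n) f)
  braiding_naturality_left f Z := (Q.braid_natural f (Q.id Z.n))
  hexagon_reverse X Y Z := Q.hexagon_reverse X Y Z
  hexagon_forward X Y Z := by
    have h := congrArg Iso.inv (Iso.ext (α := (α_ Y Z X).symm ≪≫ Q.braidIso (Y ⊗ Z) X ≪≫
      (α_ X Y Z).symm) (β := whiskerLeftIso Y (Q.braidIso Z X) ≪≫ (α_ Y X Z).symm ≪≫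
        whiskerRightIso (Q.braidIso Y X) Z) (Q.hexagon_reverse Y Z X))
    simp only [Iso.trans_inv, Iso.symm_inv, whiskerLeftIso_inv, whiskerRightIso_inv,
      Category.assoc] at h
    exact h
  symmetry X Y := Q.braid_braid X.n Y.n

end PROP

/-! ### Commutative monoid objects in a symmetric monoidal category -/

namespace CategoryTheory

open MonoidalCategory CategoryTheory.MonObj CategoryTheory.ComonObj

variable {C : Type u} [Category.{v} C] [MonoidalCategory C]

/-- The inclusion of the first factor into a tensor product of monoid objects. -/
def tensorInl (Y Z : C) [MonObj Z] : Y ⟶ Y ⊗ Z :=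
  (ρ_ Y).inv ≫ Y ◁ η

/-- The inclusion of the second factor into a tensor product of monoid objects. -/
def tensorInr (Y Z : C) [MonObj Y] : Z ⟶ Y ⊗ Z :=
  (λ_ Z).inv ≫ η ▷ Z

/-- The morphism from a tensor product given by two morphisms to a monoid object. -/
def tensorDesc {X Y Z : C} [MonObj X] (f : Y ⟶ X) (g : Z ⟶ X) : Y ⊗ Z ⟶ X :=
  (f ⊗ₘ g) ≫ μ

theorem tensorInl_desc {X Y Z : C} [MonObj X] [MonObj Z] (f : Y ⟶ X) (g : Z ⟶ X)
    [IsMonHom g] : tensorInl Y Z ≫ tensorDesc f g = f := by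
  rw [tensorInl, tensorDesc, ← id_tensorHom, Category.assoc, tensorHom_comp_tensorHom_assoc,
    Category.id_comp, IsMonHom.one_hom, mul_one_hom, Iso.inv_hom_id_assoc]

theorem tensorInr_desc {X Y Z : C} [MonObj X] [MonObj Y] (f : Y ⟶ X) (g : Z ⟶ X)
    [IsMonHom f] : tensorInr Y Z ≫ tensorDesc f g = g := by
  rw [tensorInr, tensorDesc, ← tensorHom_id, Category.assoc, tensorHom_comp_tensorHom_assoc,
    Category.id_comp, IsMonHom.one_hom, one_mul_hom, Iso.inv_hom_id_assoc]

theorem tensorInl_comp_tensorHom {X Y Z W : C} [MonObj Z] [MonObj W] (f : Y ⟶ X) (g : Z ⟶ W)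
    [IsMonHom g] : tensorInl Y Z ≫ (f ⊗ₘ g) = f ≫ tensorInl X W := by
  rw [tensorInl, tensorInl, ← id_tensorHom, Category.assoc, tensorHom_comp_tensorHom,
    Category.id_comp, IsMonHom.one_hom, rightUnitor_inv_naturality_assoc,
    ← MonoidalCategory.tensorHom_def]

theorem tensorInr_comp_tensorHom {X Y Z W : C} [MonObj Y] [MonObj X] (f : Y ⟶ X) (g : Z ⟶ W)
    [IsMonHom f] : tensorInr Y Z ≫ (f ⊗ₘ g) = g ≫ tensorInr X W := by
  rw [tensorInr, tensorInr, ← tensorHom_id, Category.assoc, tensorHom_comp_tensorHom,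
    Category.id_comp, IsMonHom.one_hom, leftUnitor_inv_naturality_assoc,
    ← MonoidalCategory.tensorHom_def']

namespace Conv

variable {A X Y : C} [ComonObj A] [MonObj X] [MonObj Y]

theorem mul_eq_tensorHom (f g : A ⟶ X) :
    HMul.hMul (α := Conv A X) (β := Conv A X) f g = Δ ≫ (f ⊗ₘ g) ≫ μ := by
  change Δ ≫ f ▷ A ≫ X ◁ g ≫ μ = _
  rw [MonoidalCategory.tensorHom_def, Category.assoc]

theorem comul_tensorHom_mul_comp (f g : A ⟶ X) (h : X ⟶ Y) [IsMonHom h] :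
    (Δ ≫ (f ⊗ₘ g) ≫ μ) ≫ h = Δ ≫ (f ≫ h ⊗ₘ g ≫ h) ≫ μ := by
  simp only [Category.assoc]
  rw [IsMonHom.mul_hom, tensorHom_comp_tensorHom_assoc]

end Conv

variable [SymmetricCategory C]

instance isMonHom_one (X : C) [MonObj X] : IsMonHom (η : 𝟙_ C ⟶ X) where
  one_hom := Category.id_comp _
  mul_hom := (one_mul_hom η).symm

instance isMonHom_mul (X : C) [MonObj X] [IsCommMonObj X] : IsMonHom (μ : X ⊗ X ⟶ X) where
  one_hom := by
    rw [tensorObj.one_def, Category.assoc, one_mul_hom, Iso.inv_hom_id_assoc]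
  mul_hom := by
    rw [tensorObj.mul_def, Category.assoc, MonObj.mul_mul_mul_comm]

instance (Y Z : C) [MonObj Y] [MonObj Z] : IsMonHom (tensorInl Y Z) :=
  inferInstanceAs (IsMonHom ((ρ_ Y).inv ≫ Y ◁ η))

instance (Y Z : C) [MonObj Y] [MonObj Z] : IsMonHom (tensorInr Y Z) :=
  inferInstanceAs (IsMonHom ((λ_ Z).inv ≫ η ▷ Z))

theorem tensorInl_tensorInr_mul (Y Z : C) [MonObj Y] [MonObj Z] :
    (tensorInl Y Z ⊗ₘ tensorInr Y Z) ≫ μ = 𝟙 (Y ⊗ Z) := by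
  have h : tensorμ Y (𝟙_ C) (𝟙_ C) Z = ((ρ_ Y).hom ⊗ₘ (λ_ Z).hom) ≫
      ((ρ_ Y).inv ⊗ₘ (λ_ Z).inv) := by
    rw [tensorμ, braiding_tensorUnit_left]
    monoidal
  rw [tensorInl, tensorInr, ← id_tensorHom, ← tensorHom_id, ← tensorHom_comp_tensorHom,
    tensorObj.mul_def, Category.assoc, tensorμ_natural_assoc, tensorHom_comp_tensorHom, h]
  simp

theorem tensor_monHom_ext {X Y Z : C} [MonObj X] [MonObj Y] [MonObj Z] {f g : Y ⊗ Z ⟶ X}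
    [IsMonHom f] [IsMonHom g] (h₁ : tensorInl Y Z ≫ f = tensorInl Y Z ≫ g)
    (h₂ : tensorInr Y Z ≫ f = tensorInr Y Z ≫ g) : f = g := by
  rw [← Category.id_comp f, ← Category.id_comp g, ← tensorInl_tensorInr_mul, Category.assoc,
    Category.assoc, IsMonHom.mul_hom, IsMonHom.mul_hom, tensorHom_comp_tensorHom_assoc,
    tensorHom_comp_tensorHom_assoc, h₁, h₂]

section tensorDesc

variable {X Y Z : C} [MonObj X] [MonObj Y] [MonObj Z] (f : Y ⟶ X) (g : Z ⟶ X)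

instance [IsCommMonObj X] [IsMonHom f] [IsMonHom g] : IsMonHom (tensorDesc f g) :=
  inferInstanceAs (IsMonHom ((f ⊗ₘ g) ≫ μ))

end tensorDesc

theorem tensorInl_comp_braiding (Y Z : C) [MonObj Z] :
    tensorInl Y Z ≫ (β_ Y Z).hom = tensorInr Z Y := by
  rw [tensorInl, tensorInr]
  simp

theorem tensorInr_comp_braiding (Y Z : C) [MonObj Y] :
    tensorInr Y Z ≫ (β_ Y Z).hom = tensorInl Z Y := by
  rw [tensorInl, tensorInr]
  simp

namespace Conv

variable {A X Y : C} [ComonObj A] [MonObj X] [MonObj Y]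

instance [IsCommComonObj A] [IsCommMonObj X] : CommMonoid (Conv A X) where
  mul_comm f g := by
    have h : ∀ f g : A ⟶ X, Δ ≫ (f ⊗ₘ g) ≫ μ = Δ ≫ (g ⊗ₘ f) ≫ μ := by
      intro f g
      conv_lhs => rw [← IsCommMonObj.mul_comm X, BraidedCategory.braiding_naturality_assoc,
        IsCommComonObj.comul_comm_assoc]
    exact (mul_eq_tensorHom f g).trans ((h f g).trans (mul_eq_tensorHom g f).symm)

theorem isMonHom_comul_tensorHom_mul [MonObj A] [IsMonHom Δ[A]] [IsCommMonObj X] (f g : A ⟶ X)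
    [IsMonHom f] [IsMonHom g] : IsMonHom (Δ ≫ (f ⊗ₘ g) ≫ μ) :=
  inferInstance

/-- The action of a homomorphism of monoid objects on convolution monoids. -/
def postcomp (A : C) [ComonObj A] (h : X ⟶ Y) [IsMonHom h] : Conv A X →* Conv A Y where
  toFun f := CategoryStruct.comp (obj := C) f h
  map_one' := by
    rw [one_eq, one_eq, Category.assoc, IsMonHom.one_hom]
  map_mul' f g := (congrArg (fun f : A ⟶ X => f ≫ h) (mul_eq_tensorHom f g)).trans
    ((comul_tensorHom_mul_comp f g h).trans (mul_eq_tensorHom _ _).symm)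

variable (A X) in
/-- The homomorphisms of monoid objects are closed under convolution. -/
def monHomSubmonoid [MonObj A] [IsMonHom Δ[A]] [IsMonHom ε[A]] [IsCommMonObj X] :
    Submonoid (Conv A X) where
  carrier := {f | IsMonHom (C := C) f}
  one_mem' := inferInstanceAs (IsMonHom (ε[A] ≫ η[X]))
  mul_mem' {f g} hf hg := by
    have hf' : IsMonHom (C := C) f := hf
    have hg' : IsMonHom (C := C) g := hg
    exact Eq.mpr (congrArg (fun h : A ⟶ X => IsMonHom h) (mul_eq_tensorHom f g))
      (isMonHom_comul_tensorHom_mul (C := C) f g)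

end Conv

end CategoryTheory

namespace CategoryTheory

open MonoidalCategory CategoryTheory.MonObj

variable {C : Type u} [Category.{v} C] [MonoidalCategory C]

theorem tensorInl_tensorInr_associator_inv (X Y Z : C) [MonObj X] [MonObj Z] :
    tensorInl Y Z ≫ tensorInr X (Y ⊗ Z) ≫ (α_ X Y Z).inv =
      tensorInr X Y ≫ tensorInl (X ⊗ Y) Z := by
  have h : Y ◁ η[Z] ≫ (λ_ (Y ⊗ Z)).inv ≫ (η[X] ▷ (Y ⊗ Z)) ≫ (α_ X Y Z).inv =
      (λ_ (Y ⊗ 𝟙_ C)).inv ≫ η[X] ▷ (Y ⊗ 𝟙_ C) ≫ X ◁ Y ◁ η[Z] ≫ (α_ X Y Z).inv := by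
    rw [← whisker_exchange_assoc, ← leftUnitor_inv_naturality_assoc]
  rw [tensorInl, tensorInl, tensorInr, tensorInr]
  simp only [Category.assoc]
  rw [h]
  monoidal

variable [SymmetricCategory C]

theorem tensorInl_associator_inv (X Y Z : C) [MonObj Y] [MonObj Z] :
    tensorInl X (Y ⊗ Z) ≫ (α_ X Y Z).inv = tensorInl X Y ≫ tensorInl (X ⊗ Y) Z := by
  rw [tensorInl, tensorInl, tensorInl, tensorObj.one_def, MonoidalCategory.tensorHom_def]
  monoidal

theorem tensorInr_tensorInr_associator_inv (X Y Z : C) [MonObj X] [MonObj Y] :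
    tensorInr Y Z ≫ tensorInr X (Y ⊗ Z) ≫ (α_ X Y Z).inv = tensorInr (X ⊗ Y) Z := by
  rw [tensorInr, tensorInr, tensorInr, tensorObj.one_def, MonoidalCategory.tensorHom_def']
  monoidal

end CategoryTheory

/-! ### The tensor powers of a bialgebra in a prop -/

namespace Bialg

open CategoryTheory MonoidalCategory MonObj ComonObj

variable {Q : PROP.{u}} (B : Bialg Q)

/-- The object `1`, with the structure of the bialgebra `B`. -/
def carrier (_ : Bialg Q) : Q.Obj := ⟨1⟩

/-- The object `n`, with the structure of a tensor power of the bialgebra `B`. -/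
def pow (_ : Bialg Q) (n : ℕ) : Q.Obj := ⟨n⟩

instance : MonObj B.carrier where
  one := B.unit
  mul := B.mul
  one_mul := B.unit_mul
  mul_one := B.mul_unit
  mul_assoc := B.mul_assoc.trans (Q.comp_id _).symm

instance : IsCommMonObj B.carrier where
  mul_comm := B.mul_comm

instance : ComonObj B.carrier where
  counit := B.counit
  comul := B.comul
  counit_comul := B.counit_comul
  comul_counit := B.comul_counit
  comul_assoc := B.comul_assoc.symm.trans
    (congrArg (fun f => Q.comp f B.comul) (Q.id_comp (Q.tensor B.comul (Q.id 1))).symm)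

instance : IsCommComonObj B.carrier where
  comul_comm := B.comul_comm

theorem tensorμ_carrier :
    tensorμ B.carrier B.carrier B.carrier B.carrier =
      Q.tensor (b := 1 + (1 + 1)) (Q.tensor (Q.id 1) (Q.braid 1 1)) (Q.id 1) := by
  have h : tensorμ B.carrier B.carrier B.carrier B.carrier = (α_ _ _ _).hom ≫
      B.carrier ◁ (α_ _ _ _).inv ≫ (α_ _ _ _).inv ≫
      (B.carrier ◁ (β_ B.carrier B.carrier).hom) ▷ B.carrier ≫ (α_ _ _ _).hom ≫
      B.carrier ◁ (α_ _ _ _).hom ≫ (α_ _ _ _).inv := by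
    simp [tensorμ]
  refine h.trans ?_
  change Q.comp (b := 4) (c := 4) (Q.comp (b := 4) (c := 4) (Q.comp (b := 4) (c := 4)
    (Q.comp (b := 4) (c := 4) (Q.comp (b := 4) (c := 4) (Q.comp (b := 4) (c := 4) (Q.id 4)
    (Q.tensor (Q.id 1) (Q.id 3))) (Q.id 4)) (Q.tensor (b := 1 + (1 + 1))
    (Q.tensor (Q.id 1) (Q.braid 1 1)) (Q.id 1))) (Q.id 4)) (Q.tensor (Q.id 1) (Q.id 3)))
    (Q.id 4) = _
  rw [Q.tensor_id]
  simp only [Q.id_comp, Q.comp_id]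

instance : IsMonHom (Δ : B.carrier ⟶ B.carrier ⊗ B.carrier) where
  one_hom := B.comul_unit.trans (Q.comp_id _).symm
  mul_hom := by
    rw [tensorObj.mul_def, tensorμ_carrier]
    exact B.comul_mul.symm

instance : IsMonHom (ε : B.carrier ⟶ 𝟙_ Q.Obj) where
  one_hom := B.counit_unit
  mul_hom := B.counit_mul.trans (Q.id_comp _).symm

/-- The monoid structure of the tensor powers of `B`. -/
@[reducible]
def powMonObj : ∀ n : ℕ, MonObj (B.pow n)
  | 0 => inferInstanceAs (MonObj (𝟙_ Q.Obj))
  | n + 1 =>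
    letI := powMonObj n
    inferInstanceAs (MonObj (B.pow n ⊗ B.carrier))

instance (n : ℕ) : MonObj (B.pow n) := B.powMonObj n

instance isCommMonObj_pow : ∀ n : ℕ, IsCommMonObj (B.pow n)
  | 0 => inferInstanceAs (IsCommMonObj (𝟙_ Q.Obj))
  | n + 1 =>
    letI := isCommMonObj_pow n
    inferInstanceAs (IsCommMonObj (B.pow n ⊗ B.carrier))

/-- The `0`-th tensor power. -/
def powZero : 𝟙_ Q.Obj ≅ B.pow 0 := Iso.refl (𝟙_ Q.Obj)

/-- The successor tensor power. -/
def powSucc (n : ℕ) : B.pow n ⊗ B.carrier ≅ B.pow (n + 1) := Iso.refl (B.pow n ⊗ B.carrier)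

/-- The sum of the exponents of two tensor powers. -/
def powAdd (a b : ℕ) : B.pow a ⊗ B.pow b ≅ B.pow (a + b) := Iso.refl (B.pow a ⊗ B.pow b)

instance : IsMonHom B.powZero.hom := inferInstanceAs (IsMonHom (𝟙 (𝟙_ Q.Obj)))

instance (n : ℕ) : IsMonHom (B.powSucc n).hom :=
  inferInstanceAs (IsMonHom (𝟙 (B.pow n ⊗ B.carrier)))

theorem powAdd_zero (a : ℕ) :
    (B.powAdd a 0).hom = B.pow a ◁ B.powZero.inv ≫ (ρ_ (B.pow a)).hom := by
  change Q.id a = Q.comp (Q.id a) (Q.tensor (Q.id a) (Q.id 0))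
  rw [Q.tensor_id, Q.id_comp]
  rfl

theorem powAdd_succ (a b : ℕ) :
    (B.powAdd a (b + 1)).hom = B.pow a ◁ (B.powSucc b).inv ≫ (α_ _ _ _).inv ≫
      (B.powAdd a b).hom ▷ B.carrier ≫ (B.powSucc (a + b)).hom := by
  change Q.id (a + b + 1) = Q.comp (Q.comp (Q.comp (Q.id (a + b + 1))
    (Q.tensor (Q.id (a + b)) (Q.id 1))) (Q.id (a + b + 1))) 
    (Q.tensor (a := a) (b := a) (c := b + 1) (d := b + 1) (Q.id a) (Q.id (b + 1)))
  rw [Q.tensor_id, Q.tensor_id]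
  simp only [Q.id_comp]
  rfl

instance isMonHom_powAdd (a : ℕ) : ∀ b : ℕ, IsMonHom (B.powAdd a b).hom
  | 0 => by
    rw [powAdd_zero]
    infer_instance
  | b + 1 => by
    have := isMonHom_powAdd a b
    rw [powAdd_succ]
    infer_instance

/-- The inclusions of `B` into its tensor powers. -/
def incl : ∀ n : ℕ, Fin n → (B.carrier ⟶ B.pow n)
  | 0 => fun j => j.elim0
  | n + 1 => Fin.lastCases (tensorInr (B.pow n) B.carrier ≫ (B.powSucc n).hom)
      (fun j => incl n j ≫ tensorInl (B.pow n) B.carrier ≫ (B.powSucc n).hom)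

theorem incl_last (n : ℕ) : B.incl (n + 1) (Fin.last n) =
    tensorInr (B.pow n) B.carrier ≫ (B.powSucc n).hom := by
  rw [incl]
  exact Fin.lastCases_last

theorem incl_castSucc (n : ℕ) (j : Fin n) : B.incl (n + 1) j.castSucc =
    B.incl n j ≫ tensorInl (B.pow n) B.carrier ≫ (B.powSucc n).hom := by
  rw [incl]
  exact Fin.lastCases_castSucc j

instance isMonHom_incl : ∀ (n : ℕ) (j : Fin n), IsMonHom (B.incl n j)
  | n + 1, j => by
    refine Fin.lastCases ?_ (fun j => ?_) j
    · rw [incl_last]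
      infer_instance
    · have := isMonHom_incl n j
      rw [incl_castSucc]
      infer_instance

theorem incl_castAdd {a : ℕ} (b : ℕ) (j : Fin a) : B.incl (a + b) (Fin.castAdd b j) =
    B.incl a j ≫ tensorInl (B.pow a) (B.pow b) ≫ (B.powAdd a b).hom := by
  induction b with
  | zero =>
    rw [powAdd_zero, tensorInl, Category.assoc, ← MonoidalCategory.whiskerLeft_comp_assoc,
      IsMonHom.one_hom]
    change _ = B.incl a j ≫ (ρ_ (B.pow a)).inv ≫ B.pow a ◁ 𝟙 (𝟙_ Q.Obj) ≫ (ρ_ (B.pow a)).hom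
    simp
  | succ b ih =>
    have h : tensorInl (B.pow a) (B.pow (b + 1)) ≫ B.pow a ◁ (B.powSucc b).inv =
        tensorInl (B.pow a) (B.pow b ⊗ B.carrier) := by
      rw [tensorInl, tensorInl, Category.assoc, ← MonoidalCategory.whiskerLeft_comp,
        IsMonHom.one_hom]
    have h' := B.incl_castSucc (a + b) (Fin.castAdd b j)
    refine h'.trans ?_
    rw [ih, powAdd_succ, reassoc_of% h, reassoc_of% tensorInl_associator_inv,
      ← tensorHom_id, reassoc_of% (tensorInl_comp_tensorHom (B.powAdd a b).hom (𝟙 B.carrier))]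
    simp only [Category.assoc]

theorem incl_natAdd (a : ℕ) {b : ℕ} (j : Fin b) : B.incl (a + b) (Fin.natAdd a j) =
    B.incl b j ≫ tensorInr (B.pow a) (B.pow b) ≫ (B.powAdd a b).hom := by
  induction b with
  | zero => exact j.elim0
  | succ b ih =>
    have h : (B.powSucc b).hom ≫ tensorInr (B.pow a) (B.pow (b + 1)) ≫
        B.pow a ◁ (B.powSucc b).inv = tensorInr (B.pow a) (B.pow b ⊗ B.carrier) := by
      rw [tensorInr, tensorInr, Category.assoc, ← whisker_exchange, leftUnitor_inv_naturality_assoc]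
      simp
    refine Fin.lastCases ?_ (fun j => ?_) j
    · have h' := B.incl_last (a + b)
      refine h'.trans ?_
      rw [powAdd_succ, incl_last, Category.assoc, reassoc_of% h,
        reassoc_of% tensorInr_tensorInr_associator_inv, ← tensorHom_id,
        reassoc_of% (tensorInr_comp_tensorHom (B.powAdd a b).hom (𝟙 B.carrier))]
    · have h' := B.incl_castSucc (a + b) (Fin.natAdd a j)
      refine h'.trans ?_
      simp only [ih, powAdd_succ, incl_castSucc, Category.assoc]
      rw [reassoc_of% h,
        reassoc_of% tensorInl_tensorInr_associator_inv, ← tensorHom_id,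
        reassoc_of% (tensorInl_comp_tensorHom (B.powAdd a b).hom (𝟙 B.carrier))]

variable {B} in
theorem pow_monHom_ext {n : ℕ} {X : Q.Obj} [MonObj X] {f g : B.pow n ⟶ X} [hf : IsMonHom f]
    [hg : IsMonHom g] (h : ∀ j, B.incl n j ≫ f = B.incl n j ≫ g) : f = g := by
  induction n with
  | zero => exact (Category.id_comp f).symm.trans ((hf.one_hom.trans hg.one_hom.symm).trans
      (Category.id_comp g))
  | succ n ih =>
    rw [← cancel_epi (B.powSucc n).hom]
    refine tensor_monHom_ext (ih fun j => ?_) ?_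
    · simpa [incl_castSucc] using h j.castSucc
    · simpa [incl_last] using h (Fin.last n)

/-- The morphism from a tensor power of `B` given by its restrictions to the factors. -/
def desc {X : Q.Obj} [MonObj X] : ∀ {n : ℕ}, (Fin n → (B.carrier ⟶ X)) → (B.pow n ⟶ X)
  | 0, _ => B.powZero.inv ≫ η
  | n + 1, v => (B.powSucc n).inv ≫ tensorDesc (desc fun j => v j.castSucc) (v (Fin.last n))

theorem isMonHom_desc {X : Q.Obj} [MonObj X] [IsCommMonObj X] :
    ∀ {n : ℕ} (v : Fin n → (B.carrier ⟶ X)), (∀ j, IsMonHom (v j)) → IsMonHom (B.desc v)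
  | 0, v, _ => by
    rw [desc]
    infer_instance
  | n + 1, v, hv => by
    have := isMonHom_desc (fun j => v j.castSucc) fun j => hv j.castSucc
    have := hv (Fin.last n)
    rw [desc]
    infer_instance

theorem incl_desc {X : Q.Obj} [MonObj X] [IsCommMonObj X] {n : ℕ} (v : Fin n → (B.carrier ⟶ X))
    (hv : ∀ j, IsMonHom (v j)) (j : Fin n) : B.incl n j ≫ B.desc v = v j := by
  induction n with
  | zero => exact j.elim0
  | succ n ih =>
    have := B.isMonHom_desc (fun j => v j.castSucc) fun j => hv j.castSucc
    have := hv (Fin.last n)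
    refine Fin.lastCases ?_ (fun j => ?_) j
    · rw [desc, incl_last, Category.assoc, Iso.hom_inv_id_assoc, tensorInr_desc]
    · rw [desc, incl_castSucc, Category.assoc, Category.assoc, Iso.hom_inv_id_assoc,
        tensorInl_desc]
      exact ih _ (fun j => hv j.castSucc) j

end Bialg

/-! ### Monomials in a commutative monoid -/

section monomial

variable {G : Type u} [CommMonoid G]

/-- The monomial with exponents `m` in the elements `v`. -/
def finMonomial {b : ℕ} (v : Fin b → G) (m : Fin b → ℕ) : G :=
  ∏ i, v i ^ m i

theorem finMonomial_single {b : ℕ} (v : Fin b → G) (m : Fin b → ℕ) (j : Fin b) (hj : m j = 1)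
    (h : ∀ i, i ≠ j → m i = 0) : finMonomial v m = v j := by
  rw [finMonomial, Finset.prod_eq_single j, hj, pow_one]
  · intro i _ hi
    rw [h i hi, pow_zero]
  · intro hj
    exact absurd (Finset.mem_univ j) hj

theorem finMonomial_finMonomial {b c : ℕ} (v : Fin c → G) (M : Matrix (Fin c) (Fin b) ℕ)
    (m : Fin b → ℕ) : finMonomial (fun i => finMonomial v fun k => M k i) m =
      finMonomial v fun k => ∑ i, M k i * m i := by
  simp only [finMonomial, ← Finset.prod_pow, ← pow_mul, ← Finset.prod_pow_eq_pow_sum]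
  exact Finset.prod_comm

theorem finMonomial_castAdd {b d : ℕ} (v : Fin (b + d) → G) (m : Fin (b + d) → ℕ)
    (h : ∀ i, m (Fin.natAdd b i) = 0) : finMonomial v m =
      finMonomial (fun i => v (Fin.castAdd d i)) fun i => m (Fin.castAdd d i) := by
  simp only [finMonomial, Fin.prod_univ_add, h, pow_zero, Finset.prod_const_one, mul_one]

theorem finMonomial_natAdd {b d : ℕ} (v : Fin (b + d) → G) (m : Fin (b + d) → ℕ)
    (h : ∀ i, m (Fin.castAdd d i) = 0) : finMonomial v m =
      finMonomial (fun i => v (Fin.natAdd b i)) fun i => m (Fin.natAdd b i) := by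
  simp only [finMonomial, Fin.prod_univ_add, h, pow_zero, Finset.prod_const_one, one_mul]

theorem finMonomial_one_one (v : Fin 2 → G) (m : Fin 2 → ℕ) (h : ∀ i, m i = 1) :
    finMonomial v m = v 0 * v 1 := by
  simp only [finMonomial, Fin.prod_univ_two, h, pow_one]

theorem finMonomial_empty (v : Fin 0 → G) (m : Fin 0 → ℕ) : finMonomial v m = 1 := by
  simp only [finMonomial, Finset.univ_eq_empty, Finset.prod_empty]

theorem map_finMonomial {H : Type v} [CommMonoid H] (f : G →* H) {b : ℕ} (v : Fin b → G)
    (m : Fin b → ℕ) : f (finMonomial v m) = finMonomial (fun i => f (v i)) m := by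
  simp only [finMonomial, map_prod, map_pow]

theorem finMonomial_mem (S : Submonoid G) {b : ℕ} {v : Fin b → G} (m : Fin b → ℕ)
    (h : ∀ i, v i ∈ S) : finMonomial v m ∈ S :=
  S.prod_mem fun i _ => S.pow_mem (h i) _

end monomial

namespace Bialg

open CategoryTheory MonoidalCategory MonObj ComonObj

variable {Q : PROP.{u}} (B : Bialg Q)

/-- The monomial with exponents `m` in the morphisms `v`, for the convolution product. -/
def convMonomial {X : Q.Obj} [MonObj X] [IsCommMonObj X] {b : ℕ} (v : Fin b → (B.carrier ⟶ X))
    (m : Fin b → ℕ) : B.carrier ⟶ X :=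
  finMonomial (G := Conv B.carrier X) v m

theorem convMonomial_comp {X Y : Q.Obj} [MonObj X] [IsCommMonObj X] [MonObj Y] [IsCommMonObj Y]
    {b : ℕ} (v : Fin b → (B.carrier ⟶ X)) (m : Fin b → ℕ) (h : X ⟶ Y) [IsMonHom h] :
    B.convMonomial v m ≫ h = B.convMonomial (fun i => v i ≫ h) m :=
  map_finMonomial (Conv.postcomp B.carrier h) v m

/-- The combination of inclusions of `B` that corresponds to a column of a matrix. -/
def col {a b : ℕ} (M : Matrix (Fin b) (Fin a) ℕ) (j : Fin a) : B.carrier ⟶ B.pow b :=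
  B.convMonomial (B.incl b) fun i => M i j

instance isMonHom_col {a b : ℕ} (M : Matrix (Fin b) (Fin a) ℕ) (j : Fin a) :
    IsMonHom (B.col M j) :=
  finMonomial_mem (Conv.monHomSubmonoid B.carrier (B.pow b)) (fun i => M i j) (B.isMonHom_incl b)

/-- The morphism between tensor powers of `B` given by a matrix. -/
def matHom {a b : ℕ} (M : Matrix (Fin b) (Fin a) ℕ) : B.pow a ⟶ B.pow b :=
  B.desc (B.col M)

instance {a b : ℕ} (M : Matrix (Fin b) (Fin a) ℕ) : IsMonHom (B.matHom M) :=
  B.isMonHom_desc _ (B.isMonHom_col M)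

theorem incl_matHom {a b : ℕ} (M : Matrix (Fin b) (Fin a) ℕ) (j : Fin a) :
    B.incl a j ≫ B.matHom M = B.col M j :=
  B.incl_desc _ (B.isMonHom_col M) j

theorem eq_matHom {a b : ℕ} (M : Matrix (Fin b) (Fin a) ℕ) (h : B.pow a ⟶ B.pow b) [IsMonHom h]
    (hM : ∀ j, B.incl a j ≫ h = B.col M j) : B.matHom M = h :=
  pow_monHom_ext fun j => (B.incl_matHom M j).trans (hM j).symm

theorem matHom_one (a : ℕ) : B.matHom (1 : Matrix (Fin a) (Fin a) ℕ) = 𝟙 (B.pow a) := by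
  refine B.eq_matHom _ _ fun j => ?_
  rw [Category.comp_id]
  exact (finMonomial_single (G := Conv B.carrier (B.pow a)) _
    (fun i => (1 : Matrix (Fin a) (Fin a) ℕ) i j) j (Matrix.one_apply_eq j)
    fun i hi => Matrix.one_apply_ne hi).symm

theorem matHom_mul {a b c : ℕ} (M : Matrix (Fin c) (Fin b) ℕ) (N : Matrix (Fin b) (Fin a) ℕ) :
    B.matHom (M * N) = B.matHom N ≫ B.matHom M := by
  refine B.eq_matHom _ _ fun j => ?_
  rw [← Category.assoc, incl_matHom, col, convMonomial_comp]
  simp only [incl_matHom]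
  exact finMonomial_finMonomial (G := Conv B.carrier (B.pow c)) _ M _

theorem matHom_directSum {a b c d : ℕ} (M : Matrix (Fin b) (Fin a) ℕ)
    (N : Matrix (Fin d) (Fin c) ℕ) : B.matHom (directSum M N) =
      (B.powAdd a c).inv ≫ (B.matHom M ⊗ₘ B.matHom N) ≫ (B.powAdd b d).hom := by
  refine B.eq_matHom _ _ fun j => Fin.addCases (fun j => ?_) (fun j => ?_) j
  · rw [incl_castAdd]
    simp only [Category.assoc, Iso.hom_inv_id_assoc]
    rw [reassoc_of% (tensorInl_comp_tensorHom (B.matHom M) (B.matHom N)), ← Category.assoc,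
      incl_matHom, col, convMonomial_comp]
    simp only [← incl_castAdd]
    refine Eq.trans ?_ (finMonomial_castAdd (G := Conv B.carrier (B.pow (b + d))) _ _ ?_).symm
    · exact congrArg (B.convMonomial _) (funext fun i => by simp [directSum])
    · simp [directSum]
  · rw [incl_natAdd]
    simp only [Category.assoc, Iso.hom_inv_id_assoc]
    rw [reassoc_of% (tensorInr_comp_tensorHom (B.matHom M) (B.matHom N)), ← Category.assoc,
      incl_matHom, col, convMonomial_comp]
    simp only [← incl_natAdd]
    refine Eq.trans ?_ (finMonomial_natAdd (G := Conv B.carrier (B.pow (b + d))) _ _ ?_).symm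
    · exact congrArg (B.convMonomial _) (funext fun i => by simp [directSum])
    · simp [directSum]

theorem matHom_swapMatrix (a b : ℕ) : B.matHom (swapMatrix ℕ a b) =
    (B.powAdd a b).inv ≫ (β_ (B.pow a) (B.pow b)).hom ≫ (B.powAdd b a).hom := by
  refine B.eq_matHom _ _ fun j => Fin.addCases (fun j => ?_) (fun j => ?_) j
  · rw [incl_castAdd]
    simp only [Category.assoc, Iso.hom_inv_id_assoc]
    rw [reassoc_of% (tensorInl_comp_braiding (B.pow a) (B.pow b)), ← incl_natAdd]
    refine (finMonomial_single (G := Conv B.carrier (B.pow (b + a))) _ _ (Fin.natAdd b j)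
      ?_ fun i hi => ?_).symm
    · simp [swapMatrix]
    · refine Fin.addCases (fun i _ => ?_) (fun i hi => ?_) i hi
      · simp [swapMatrix]
      · have : i ≠ j := fun h => hi (h ▸ rfl)
        simp [swapMatrix, this]
  · rw [incl_natAdd]
    simp only [Category.assoc, Iso.hom_inv_id_assoc]
    rw [reassoc_of% (tensorInr_comp_braiding (B.pow a) (B.pow b)), ← incl_castAdd]
    refine (finMonomial_single (G := Conv B.carrier (B.pow (b + a))) _ _ (Fin.castAdd a j)
      ?_ fun i hi => ?_).symm
    · simp [swapMatrix]
    · refine Fin.addCases (fun i hi => ?_) (fun i _ => ?_) i hi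
      · have : i ≠ j := fun h => hi (h ▸ rfl)
        simp [swapMatrix, this]
      · simp [swapMatrix]

/-- The prop functor from matrices over `ℕ` given by a bialgebra. -/
def matFunctor : PROPFunctor (matPROP ℕ) Q where
  map M := B.matHom M
  map_id a := B.matHom_one a
  map_comp M N := B.matHom_mul M N
  map_tensor M N := (B.matHom_directSum M N).trans ((Q.comp_id _).trans (Q.id_comp _))
  map_braid a b := (B.matHom_swapMatrix a b).trans ((Q.comp_id _).trans (Q.id_comp _))

/-- The first tensor power. -/
def powOne : B.carrier ≅ B.pow 1 := Iso.refl B.carrier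

theorem incl_one (j : Fin 1) : B.incl 1 j = B.powOne.hom := by
  rw [Subsingleton.elim j (Fin.last 0)]
  refine (B.incl_last 0).trans ?_
  change Q.comp (Q.id 1) (Q.comp (Q.tensor (Q.id 0) (Q.id 1)) (Q.id 1)) = Q.id 1
  rw [Q.tensor_id]
  simp only [Q.id_comp]

instance : IsMonHom B.powOne.hom := by
  rw [← B.incl_one 0]
  infer_instance

theorem matHom_mul_generator :
    B.matHom !![1, 1] = (B.powSucc 1).inv ≫ tensorDesc B.powOne.inv (𝟙 _) ≫ B.powOne.hom := by
  have h : ∀ j, B.powOne.hom = B.col !![1, 1] j := fun j =>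
    (B.incl_one 0).symm.trans (finMonomial_single (G := Conv B.carrier (B.pow 1)) _ _ 0
      (by fin_cases j <;> rfl) fun i hi => absurd (Subsingleton.elim i 0) hi).symm
  refine B.eq_matHom _ _ fun j => Eq.trans ?_ (h j)
  refine Fin.lastCases ?_ (fun j => ?_) j
  · rw [incl_last]
    simp only [Category.assoc, Iso.hom_inv_id_assoc]
    rw [reassoc_of% (tensorInr_desc B.powOne.inv (𝟙 B.carrier))]
  · rw [incl_castSucc, incl_one]
    simp only [Category.assoc, Iso.hom_inv_id_assoc]
    rw [reassoc_of% (tensorInl_desc B.powOne.inv (𝟙 B.carrier)), Iso.hom_inv_id_assoc]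

theorem matHom_unit : B.matHom (0 : Matrix (Fin 1) (Fin 0) ℕ) =
    B.powZero.inv ≫ η ≫ B.powOne.hom :=
  B.eq_matHom _ _ fun j => j.elim0

theorem matHom_comul : B.matHom !![1; 1] =
    B.powOne.inv ≫ Δ ≫ B.powOne.hom ▷ B.carrier ≫ (B.powSucc 1).hom := by
  refine B.eq_matHom _ _ fun j => ?_
  rw [incl_one, Iso.hom_inv_id_assoc]
  refine Eq.trans ?_ ((Conv.mul_eq_tensorHom (B.incl 2 0) (B.incl 2 1)).symm.trans
    (finMonomial_one_one (G := Conv B.carrier (B.pow 2)) _ _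
      fun i => by fin_cases i <;> fin_cases j <;> rfl).symm)
  have h₀ : B.incl 2 0 = B.powOne.hom ≫ tensorInl (B.pow 1) B.carrier ≫ (B.powSucc 1).hom :=
    (B.incl_castSucc 1 0).trans (by rw [incl_one])
  have h₁ : B.incl 2 1 = 𝟙 _ ≫ tensorInr (B.pow 1) B.carrier ≫ (B.powSucc 1).hom :=
    (B.incl_last 1).trans (Category.id_comp _).symm
  rw [h₀, h₁, ← tensorHom_comp_tensorHom, ← tensorHom_comp_tensorHom, Category.assoc,
    Category.assoc, ← IsMonHom.mul_hom, reassoc_of% tensorInl_tensorInr_mul, tensorHom_id]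

theorem matHom_counit : B.matHom (0 : Matrix (Fin 0) (Fin 1) ℕ) =
    B.powOne.inv ≫ ε ≫ B.powZero.hom := by
  refine B.eq_matHom _ _ fun j => ?_
  rw [incl_one, Iso.hom_inv_id_assoc]
  refine Eq.trans ?_ (finMonomial_empty (G := Conv B.carrier (B.pow 0)) (B.incl 0)
    fun i => i.elim0).symm
  refine Eq.trans ?_ Conv.one_eq.symm
  rw [← IsMonHom.one_hom B.powZero.hom]
  exact congrArg (fun f => ε[B.carrier] ≫ f) (Category.id_comp _).symm

theorem image_matFunctor : matBialg.image B.matFunctor = B := by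
  refine Bialg.ext ?_ ?_ ?_ ?_
  · refine B.matHom_mul_generator.trans ?_
    change Q.comp (Q.comp (Q.id 1) (Q.comp B.mul (Q.tensor (Q.id 1) (Q.id 1)))) (Q.id 2) = B.mul
    rw [Q.tensor_id]
    simp only [Q.id_comp, Q.comp_id]
  · refine B.matHom_unit.trans ?_
    change Q.comp (Q.comp (Q.id 1) B.unit) (Q.id 0) = B.unit
    simp only [Q.id_comp, Q.comp_id]
  · refine B.matHom_comul.trans ?_
    change Q.comp (Q.comp (Q.comp (Q.id 2) (Q.tensor (Q.id 1) (Q.id 1))) B.comul) (Q.id 1) =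
      B.comul
    rw [Q.tensor_id]
    simp only [Q.comp_id, Q.id_comp]
  · refine B.matHom_counit.trans ?_
    change Q.comp (Q.comp (Q.id 0) B.counit) (Q.id 1) = B.counit
    simp only [Q.id_comp, Q.comp_id]

end Bialg

/-! ### The matrices over `ℕ` are generated by the standard bialgebra -/

theorem directSum_mulVec_castAdd {a b c d : ℕ} (A : Matrix (Fin b) (Fin a) ℕ)
    (B : Matrix (Fin d) (Fin c) ℕ) (v : Fin (a + c) → ℕ) (i : Fin b) :
    (directSum A B).mulVec v (Fin.castAdd d i) =
      A.mulVec (fun j => v (Fin.castAdd c j)) i := by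
  simp [Matrix.mulVec, dotProduct, Fin.sum_univ_add, directSum]

theorem directSum_mulVec_natAdd {a b c d : ℕ} (A : Matrix (Fin b) (Fin a) ℕ)
    (B : Matrix (Fin d) (Fin c) ℕ) (v : Fin (a + c) → ℕ) (i : Fin d) :
    (directSum A B).mulVec v (Fin.natAdd b i) =
      B.mulVec (fun j => v (Fin.natAdd a j)) i := by
  simp [Matrix.mulVec, dotProduct, Fin.sum_univ_add, directSum]

/-- The matrix `M` with an additional last column `c`. -/
def snocCol {a b : ℕ} (M : Matrix (Fin b) (Fin a) ℕ) (c : Fin b → ℕ) :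
    Matrix (Fin b) (Fin (a + 1)) ℕ :=
  Matrix.of fun i => Fin.snoc (M i) (c i)

theorem snocCol_mulVec {a b : ℕ} (M : Matrix (Fin b) (Fin a) ℕ) (c : Fin b → ℕ)
    (v : Fin (a + 1) → ℕ) (i : Fin b) : (snocCol M c).mulVec v i =
      M.mulVec (fun j => v (Fin.castAdd 1 j)) i + c i * v (Fin.natAdd a 0) := by
  simp only [Matrix.mulVec, dotProduct, Fin.sum_univ_castSucc, snocCol, Matrix.of_apply,
    Fin.snoc_castSucc, Fin.snoc_last]
  rfl

theorem snocCol_eq_mul {a b : ℕ} (M : Matrix (Fin b) (Fin a) ℕ) (c : Fin b → ℕ) :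
    snocCol M c = snocCol (1 : Matrix (Fin b) (Fin b) ℕ) c *
      directSum M (1 : Matrix (Fin 1) (Fin 1) ℕ) := by
  refine Matrix.ext_iff_mulVec.2 fun v => funext fun i => ?_
  rw [← Matrix.mulVec_mulVec, snocCol_mulVec, snocCol_mulVec, directSum_mulVec_natAdd,
    Matrix.one_mulVec, Matrix.one_mulVec, directSum_mulVec_castAdd]

theorem swapMatrix_one_one_mulVec (v : Fin 2 → ℕ) :
    (swapMatrix ℕ 1 1).mulVec v 0 = v 1 ∧ (swapMatrix ℕ 1 1).mulVec v 1 = v 0 := by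
  have h : swapMatrix ℕ 1 1 = (!![0, 1; 1, 0] : Matrix (Fin 2) (Fin 2) ℕ) := by decide
  rw [h]
  constructor <;> simp [Matrix.mulVec, dotProduct]

theorem directSum_one_one (x y : ℕ) : directSum (!![x] : Matrix (Fin 1) (Fin 1) ℕ)
    (!![y] : Matrix (Fin 1) (Fin 1) ℕ) = (!![x, 0; 0, y] : Matrix (Fin 2) (Fin 2) ℕ) :=
  Matrix.ext fun i j => by fin_cases i <;> fin_cases j <;> rfl

/-- The permutation matrix that exchanges the last two coordinates. -/
def swapLast (b : ℕ) : Matrix (Fin (b + 2)) (Fin (b + 2)) ℕ :=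
  directSum (1 : Matrix (Fin b) (Fin b) ℕ) (swapMatrix ℕ 1 1)

theorem swapLast_mulVec {b : ℕ} (v : Fin (b + 2) → ℕ) :
    (∀ i, (swapLast b).mulVec v (Fin.castAdd 2 i) = v (Fin.castAdd 2 i)) ∧
      (swapLast b).mulVec v (Fin.natAdd b 0) = v (Fin.natAdd b 1) ∧
      (swapLast b).mulVec v (Fin.natAdd b 1) = v (Fin.natAdd b 0) :=
  ⟨fun i => (directSum_mulVec_castAdd 1 (swapMatrix ℕ 1 1) v i).trans (by rw [Matrix.one_mulVec]),
    (directSum_mulVec_natAdd 1 (swapMatrix ℕ 1 1) v 0).trans (swapMatrix_one_one_mulVec _).1,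
    (directSum_mulVec_natAdd 1 (swapMatrix ℕ 1 1) v 1).trans (swapMatrix_one_one_mulVec _).2⟩

theorem directSum_swapLast_mulVec {b : ℕ} (w : Fin (b + 2 + 1) → ℕ) (w' : Fin (b + 1 + 2) → ℕ)
    (hw : w' = (directSum (swapLast b) (1 : Matrix (Fin 1) (Fin 1) ℕ)).mulVec w) :
    (∀ i : Fin b, w' (Fin.castAdd 2 (Fin.castAdd 1 i)) = w (Fin.castAdd 1 (Fin.castAdd 2 i))) ∧
      w' (Fin.castAdd 2 (Fin.natAdd b 0)) = w (Fin.castAdd 1 (Fin.natAdd b 1)) ∧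
      w' (Fin.natAdd (b + 1) 0) = w (Fin.castAdd 1 (Fin.natAdd b 0)) ∧
      w' (Fin.natAdd (b + 1) 1) = w (Fin.natAdd (b + 2) 0) := by
  subst hw
  obtain ⟨h₀, h₁, h₂⟩ := swapLast_mulVec fun j => w (Fin.castAdd 1 j)
  exact ⟨fun i => (directSum_mulVec_castAdd (swapLast b) 1 w (Fin.castAdd 2 i)).trans (h₀ i),
    (directSum_mulVec_castAdd (swapLast b) 1 w (Fin.natAdd b 0)).trans h₁,
    (directSum_mulVec_castAdd (swapLast b) 1 w (Fin.natAdd b 1)).trans h₂,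
    (directSum_mulVec_natAdd (swapLast b) 1 w 0).trans (by rw [Matrix.one_mulVec])⟩

theorem snocCol_one_succ {b : ℕ} (c : Fin b → ℕ) (x : ℕ) :
    snocCol (1 : Matrix (Fin (b + 1)) (Fin (b + 1)) ℕ) (Fin.snoc c x) =
      directSum (snocCol (1 : Matrix (Fin b) (Fin b) ℕ) c) !![1, x] *
        (directSum (swapLast b) (1 : Matrix (Fin 1) (Fin 1) ℕ) *
        directSum (1 : Matrix (Fin (b + 1)) (Fin (b + 1)) ℕ) !![1; 1]) := by
  refine Matrix.ext_iff_mulVec.2 fun v => funext fun i => ?_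
  obtain ⟨h₀, h₁, h₂, h₃⟩ := directSum_swapLast_mulVec
    ((directSum (1 : Matrix (Fin (b + 1)) (Fin (b + 1)) ℕ)
      (!![1; 1] : Matrix (Fin 2) (Fin 1) ℕ)).mulVec v) _ rfl
  rw [← Matrix.mulVec_mulVec, ← Matrix.mulVec_mulVec, snocCol_mulVec, Matrix.one_mulVec]
  refine Fin.addCases (fun i => ?_) (fun i => ?_) i
  · have hc : (Fin.snoc c x : Fin (b + 1) → ℕ) (Fin.castAdd 1 i) = c i :=
      Fin.snoc_castSucc (α := fun _ => ℕ) x c i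
    have h₀' := directSum_mulVec_castAdd (1 : Matrix (Fin (b + 1)) (Fin (b + 1)) ℕ)
      (!![1; 1] : Matrix (Fin 2) (Fin 1) ℕ) v (Fin.castAdd 1 i)
    have h₁' := directSum_mulVec_natAdd (1 : Matrix (Fin (b + 1)) (Fin (b + 1)) ℕ)
      (!![1; 1] : Matrix (Fin 2) (Fin 1) ℕ) v 0
    rw [Matrix.one_mulVec] at h₀'
    rw [directSum_mulVec_castAdd, snocCol_mulVec, Matrix.one_mulVec, h₀, h₁, hc]
    refine congrArg₂ (· + c i * ·) h₀'.symm (h₁'.trans ?_).symm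
    simp [Matrix.mulVec, dotProduct]
  · have hr : ∀ w : Fin 2 → ℕ, Matrix.mulVec !![1, x] w 0 = w 0 + x * w 1 := fun w => by
      simp [Matrix.mulVec, dotProduct]
    have hc : (Fin.snoc c x : Fin (b + 1) → ℕ) (Fin.natAdd b 0) = x :=
      Fin.snoc_last (α := fun _ => ℕ) x c
    have h₂' := directSum_mulVec_castAdd (1 : Matrix (Fin (b + 1)) (Fin (b + 1)) ℕ)
      (!![1; 1] : Matrix (Fin 2) (Fin 1) ℕ) v (Fin.natAdd b 0)
    have h₃' := directSum_mulVec_natAdd (1 : Matrix (Fin (b + 1)) (Fin (b + 1)) ℕ)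
      (!![1; 1] : Matrix (Fin 2) (Fin 1) ℕ) v 1
    rw [Matrix.one_mulVec] at h₂'
    rw [Subsingleton.elim i 0, directSum_mulVec_natAdd, hr, h₂, h₃, hc]
    refine congrArg₂ (· + x * ·) h₂'.symm (h₃'.trans ?_).symm
    simp [Matrix.mulVec, dotProduct]

theorem matrix_induction {S : ∀ {a b : ℕ}, Matrix (Fin b) (Fin a) ℕ → Prop}
    (id : ∀ a, S (1 : Matrix (Fin a) (Fin a) ℕ))
    (mul : ∀ {a b c : ℕ} (M : Matrix (Fin c) (Fin b) ℕ) (N : Matrix (Fin b) (Fin a) ℕ),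
      S M → S N → S (M * N))
    (directSum : ∀ {a b c d : ℕ} (M : Matrix (Fin b) (Fin a) ℕ) (N : Matrix (Fin d) (Fin c) ℕ),
      S M → S N → S (directSum M N))
    (swap : S (swapMatrix ℕ 1 1))
    (add : S (!![1, 1] : Matrix (Fin 1) (Fin 2) ℕ))
    (zero : S (0 : Matrix (Fin 1) (Fin 0) ℕ))
    (diag : S (!![1; 1] : Matrix (Fin 2) (Fin 1) ℕ))
    (discard : S (0 : Matrix (Fin 0) (Fin 1) ℕ)) {a b : ℕ} (M : Matrix (Fin b) (Fin a) ℕ) :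
    S M := by
  have h₁ : (1 : Matrix (Fin 1) (Fin 1) ℕ) = !![1] := by decide
  have scalar : ∀ x : ℕ, S !![x] := by
    intro x
    induction x with
    | zero =>
      have h : (!![0] : Matrix (Fin 1) (Fin 1) ℕ) =
        (0 : Matrix (Fin 1) (Fin 0) ℕ) * (0 : Matrix (Fin 0) (Fin 1) ℕ) := by decide
      rw [h]
      exact mul _ _ zero discard
    | succ x ih =>
      have h : (!![x + 1] : Matrix (Fin 1) (Fin 1) ℕ) = !![1, 1] *
          (_root_.directSum !![x] (1 : Matrix (Fin 1) (Fin 1) ℕ) * !![1; 1]) := by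
        rw [h₁]
        refine Eq.trans ?_ (congrArg (fun N : Matrix (Fin 2) (Fin 2) ℕ => !![1, 1] *
          (N * !![1; 1])) (directSum_one_one x 1).symm)
        simp
      rw [h]
      exact mul _ _ add (mul _ _ (directSum _ _ ih (id 1)) diag)
  have row : ∀ x : ℕ, S !![1, x] := by
    intro x
    have h : (!![1, x] : Matrix (Fin 1) (Fin 2) ℕ) = !![1, 1] *
          _root_.directSum (1 : Matrix (Fin 1) (Fin 1) ℕ) !![x] := by
      rw [h₁]
      refine Eq.trans ?_ (congrArg (fun N : Matrix (Fin 2) (Fin 2) ℕ => !![1, 1] * N)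
        (directSum_one_one 1 x).symm)
      simp
    rw [h]
    exact mul _ _ add (directSum _ _ (id 1) (scalar x))
  have col : ∀ {b : ℕ} (c : Fin b → ℕ), S (snocCol (1 : Matrix (Fin b) (Fin b) ℕ) c) := by
    intro b
    induction b with
    | zero =>
      intro c
      have h : snocCol (1 : Matrix (Fin 0) (Fin 0) ℕ) c = (0 : Matrix (Fin 0) (Fin 1) ℕ) :=
        Subsingleton.elim _ _
      rw [h]
      exact discard
    | succ b ih =>
      intro c
      rw [← Fin.snoc_init_self c]
      rw [snocCol_one_succ]
      exact mul _ _ (directSum _ _ (ih _) (row _)) (mul _ _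
        (directSum (swapLast b) 1 (directSum _ _ (id b) swap) (id 1)) (directSum _ _ (id (b + 1)) diag))
  induction a with
  | zero =>
    induction b with
    | zero =>
      rw [Subsingleton.elim M 1]
      exact id 0
    | succ b ih =>
      have h : M = _root_.directSum (0 : Matrix (Fin b) (Fin 0) ℕ) (0 : Matrix (Fin 1) (Fin 0) ℕ) :=
        Matrix.ext fun i j => j.elim0
      rw [h]
      exact directSum _ _ (ih 0) zero
  | succ a ih =>
    have h : M = snocCol (Matrix.of fun i j => M i j.castSucc) fun i => M i (Fin.last a) := by
      refine Matrix.ext fun i j => Fin.lastCases ?_ (fun j => ?_) j <;> simp [snocCol]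
    rw [h, snocCol_eq_mul]
    exact mul _ _ (col _) (directSum _ _ (ih _) (id 1))

theorem PROPFunctor.ext_of_image_matBialg {Q : PROP.{v}} {F G : PROPFunctor (matPROP ℕ) Q}
    (h : matBialg.image F = matBialg.image G) : F = G := by
  have h' : ∀ {a b : ℕ} (M : Matrix (Fin b) (Fin a) ℕ),
      F.map (a := a) (b := b) M = G.map (a := a) (b := b) M := by
    intro a b M
    refine matrix_induction
      (S := fun {a b} M => F.map (a := a) (b := b) M = G.map (a := a) (b := b) M)
      ?_ ?_ ?_ ?_ (congrArg Bialg.mul h) (congrArg Bialg.unit h) (congrArg Bialg.comul h)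
      (congrArg Bialg.counit h) M
    · exact fun a => (F.map_id a).trans (G.map_id a).symm
    · exact fun M N hM hN => (F.map_comp M N).trans ((congrArg₂ Q.comp hM hN).trans
        (G.map_comp M N).symm)
    · exact fun M N hM hN => (F.map_tensor M N).trans ((congrArg₂ Q.tensor hM hN).trans
        (G.map_tensor M N).symm)
    · exact (F.map_braid 1 1).trans (G.map_braid 1 1).symm
  exact PROPFunctor.ext (funext fun a => funext fun b => funext fun M => h' M)

theorem IsTracedBialgebraProp.isTracedCompletion {T : TracedPROP.{0}} {B : Bialg T.toPROP}
    (hT : IsTracedBialgebraProp T B) (F : PROPFunctor (matPROP ℕ) T.toPROP)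
    (hF : matBialg.image F = B) : IsTracedCompletion T F := by
  intro Q η
  have key : ∀ G : TracedFunctor T Q, F.trans G.toPROPFunctor = η ↔
      B.image G.toPROPFunctor = matBialg.image η := by
    intro G
    have h : matBialg.image (F.trans G.toPROPFunctor) = B.image G.toPROPFunctor := by
      rw [← hF]
      rfl
    rw [← h]
    exact ⟨fun h => by rw [h], PROPFunctor.ext_of_image_matBialg⟩
  simp only [key]
  exact hT Q (matBialg.image η)

theorem mainTheorem3 :
    (∀ (R : Type u) [Semiring R] (T : TracedPROP.{u}) (ι : PROPFunctor (matPROP R) T.toPROP),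
      IsTracedCompletion T ι →
        ∀ (n m : ℕ) (M : Matrix (Fin n) (Fin n) R) (N : Matrix (Fin m) (Fin m) R),
          T.fullTrace (ι.map M) = T.fullTrace (ι.map N) ↔ PSEquiv M N) ∧
    (∀ (T : TracedPROP.{0}) (B : Bialg T.toPROP), IsTracedBialgebraProp T B →
      (∃! F : PROPFunctor (matPROP ℕ) T.toPROP, matBialg.image F = B) ∧
      ∀ F : PROPFunctor (matPROP ℕ) T.toPROP, matBialg.image F = B →
        ∀ (n m : ℕ) (M : Matrix (Fin n) (Fin n) ℕ) (N : Matrix (Fin m) (Fin m) ℕ),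
          T.fullTrace (F.map M) = T.fullTrace (F.map N) ↔ FlowEquiv M N) :=
  ⟨fun _ _ _ _ hT _ _ M N => hT.fullTrace_eq_iff M N, fun _ B hT =>
    ⟨⟨B.matFunctor, B.image_matFunctor, fun _ hF =>
      PROPFunctor.ext_of_image_matBialg (hF.trans B.image_matFunctor.symm)⟩,
    fun F hF _ _ M N => (hT.isTracedCompletion F hF).fullTrace_eq_iff M N⟩⟩
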